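/- Let $\Bbbk$ be a field of characteristic $0$. A $\mathbb Z$-graded Lie (super)algebra over $\Bbbk$ is a vector space $\mathfrak g=\bigoplus_{(n,\epsilon)\in\mathbb Z\times\mathbb Z/2}\mathfrak g_{n,\epsilon}$ (degree $n$, parity $p=\epsilon$; the parity need not be the degree mod 2) with a bilinear bracket satisfying $[\mathfrak g_{n,\epsilon},\mathfrak g_{n',\epsilon'}]\subseteq\mathfrak g_{n+n',\epsilon+\epsilon'}$ and, for homogeneous $x,y,z$, $[x,y]=-(-1)^{p(x)p(y)}[y,x]$ and $[x,[y,z]]=[[x,y],z]+(-1)^{p(x)p(y)}[y,[x,z]]$. Its universal enveloping algebra $\mathscr U(\mathfrak g)$ is the quotient of the tensor algebra $T(\mathfrak g)$ by the two-sided ideal generated by $x\otimes y-(-1)^{p(x)p(y)}y\otimes x-[x,y]$ for homogeneous $x,y$, and $\iota:\mathfrak g\to\mathscr U(\mathfrak g)$ is the canonical map. It is a $\mathbb Z\times\mathbb Z/2$-graded algebra, and a coalgebra: the comultiplication is the algebra map $\Delta:\mathscr U(\mathfrak g)\to\mathscr U(\mathfrak g)\otimes\mathscr U(\mathfrak g)$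 with $\Delta(\iota x)=\iota x\otimes1+1\otimes\iota x$, where $(a\otimes b)(a'\otimes b')=(-1)^{p(b)p(a')}aa'\otimes bb'$, and the counit is the algebra map $\mathscr U(\mathfrak g)\to\Bbbk$ killing $\iota(\mathfrak g)$. For a graded superspace $V$, $\mathrm{Sym}(V)$ is the quotient of $T(V)$ by the ideal generated by $x\otimes y-(-1)^{p(x)p(y)}y\otimes x$ (i.e. $\mathscr U(V)$ for the zero bracket), with product $\odot$ and with the corresponding grading and coalgebra structure. The tensor product of graded coalgebras carries $\Delta(a\otimes b)=\sum(-1)^{p(a_{(2)})p(b_{(1)})}(a_{(1)}\otimes b_{(1)})\otimes(a_{(2)}\otimes b_{(2)})$ and $\varepsilon(a\otimes b)=\varepsilon(a)\varepsilon(b)$. Let $\mathfrak g$ be a $\mathbb Z$-graded Lie superalgebra over $\Bbbk$ which admits a countable basis of elements homogeneous in degree and parity, let $\mathfrak h\subseteq\mathfrak g$ be a graded Lie subalgebra, and let $\mathfrak m\subseteq\mathfrak g$ be a graded subspace with $\mathfrak g=\mathfrak h\oplus\mathfrak m$. Let $j:\mathscr U(\mathfrak h)\to\mathscr U(\mathfrak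 g)$ be the algebra map induced by the inclusion. Then there is an isomorphism of $\Bbbk$-coalgebras $$\varphi:\mathscr U(\mathfrak h)\otimes\mathrm{Sym}(\mathfrak m)\xrightarrow{\ \sim\ }\mathscr U(\mathfrak g)$$ given, for all $a\in\mathscr U(\mathfrak h)$, $p\ge0$ and homogeneous $y_1,\dots,y_p\in\mathfrak m$, by $$\varphi(a\otimes y_1\odot\cdots\odot y_p)=j(a)\cdot\frac1{p!}\sum_{\sigma\in S_p}\epsilon(\sigma)\,\iota y_{\sigma(1)}\cdots\iota y_{\sigma(p)},\qquad \epsilon(\sigma)=\prod_{r<s,\ \sigma(s)<\sigma(r)}(-1)^{p(y_{\sigma(r)})p(y_{\sigma(s)})}.$$ Moreover $\varphi$ preserves degree and parity, and it is a morphism of left $\mathscr U(\mathfrak h)$-modules, where $\mathscr U(\mathfrak h)$ acts on the source by multiplication on the first factor and on $\mathscr U(\mathfrak g)$ by left multiplication through $j$. -/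

import Mathlib

open scoped TensorProduct DirectSum

noncomputable section

/-- Bidegrees `(degree, parity)`: the `ℤ`-degree and the super parity are independent, so this
covers in particular every situation in which the parity is a function of the degree. -/
abbrev Bideg : Type := ℤ × ZMod 2

/-- Bidegrees act on signs through the parity, so that `(-1) ^ (i * j) = (-1) ^ (i.2 * j.2)`. -/
instance Bideg.signModule : Module Bideg (Additive ℤˣ) :=
  Module.compHom (Additive ℤˣ) (RingHom.snd ℤ (ZMod 2))

/-- The Koszul sign `(-1) ^ (p(x) p(y))` of two elements of bidegrees `i` and `j`. -/
def koszulSign (i j : Bideg) : ℤˣ := (-1 : ℤˣ) ^ (i.2 * j.2)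

theorem uzpow_bideg (i j : Bideg) : (-1 : ℤˣ) ^ (i * j) = koszulSign i j := rfl

/-- For homogeneous elements `y 0, …, y (p-1)` of bidegrees `d 0, …, d (p-1)`, the sign `ε(σ)` with
`y 0 ⊙ … ⊙ y (p-1) = ε(σ) y (σ 0) ⊙ … ⊙ y (σ (p-1))`: the product of the Koszul signs of the
inversions of `σ`. -/
def permSign {p : ℕ} (d : Fin p → Bideg) (σ : Equiv.Perm (Fin p)) : ℤˣ :=
  ∏ i : Fin p, ∏ j : Fin p, if i < j ∧ σ j < σ i then koszulSign (d (σ i)) (d (σ j)) else 1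

/-- A `ℤ`-graded vector superspace structure on `V`: a direct sum decomposition
into the subspaces `comp (n, ε)` of elements of degree `n` and parity `ε`. -/
structure GradedSuperspace (k V : Type*) [Field k] [AddCommGroup V] [Module k V] where
  comp : Bideg → Submodule k V
  isInternal : DirectSum.IsInternal comp

/-- A graded subspace: a subspace which is the sum of its homogeneous parts. -/
structure GradedSubspace {k V : Type*} [Field k] [AddCommGroup V] [Module k V]
    (G : GradedSuperspace k V) where
  carrier : Submodule k V
  graded : carrier ≤ ⨆ d, carrier ⊓ G.comp d

/-- A `ℤ`-graded Lie superalgebra structure on `g`. -/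
structure GradedLieSuperalgebra (k g : Type*) [Field k] [AddCommGroup g] [Module k g] extends
    GradedSuperspace k g where
  bracket : g →ₗ[k] g →ₗ[k] g
  bracket_mem : ∀ {i j : Bideg} {x y : g}, x ∈ comp i → y ∈ comp j → bracket x y ∈ comp (i + j)
  skew : ∀ {i j : Bideg} {x y : g}, x ∈ comp i → y ∈ comp j →
    bracket x y = -(koszulSign i j • bracket y x)
  jacobi : ∀ {i j l : Bideg} {x y z : g}, x ∈ comp i → y ∈ comp j → z ∈ comp l →
    bracket x (bracket y z) =
      bracket (bracket x y) z + koszulSign i j • bracket y (bracket x z)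

/-- A graded Lie subalgebra. -/
structure GradedLieSubalgebra {k g : Type*} [Field k] [AddCommGroup g] [Module k g]
    (L : GradedLieSuperalgebra k g) extends GradedSubspace L.toGradedSuperspace where
  bracket_mem : ∀ {x y : g}, x ∈ carrier → y ∈ carrier → L.bracket x y ∈ carrier

/-- A graded subspace is itself a graded superspace. -/
def GradedSubspace.toSuperspace {k V : Type*} [Field k] [AddCommGroup V] [Module k V]
    {G : GradedSuperspace k V} (W : GradedSubspace G) : GradedSuperspace k W.carrier where
  comp d := (G.comp d).comap W.carrier.subtype
  isInternal := by
    have hG := (DirectSum.isInternal_submodule_iff_iSupIndep_and_iSup_eq_top _).1 G.isInternal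
    refine (DirectSum.isInternal_submodule_iff_iSupIndep_and_iSup_eq_top _).2 ⟨?_, ?_⟩
    · rw [iSupIndep_iff_finsetSum_eq_zero_imp_eq_zero]
      intro s v hv h0 i hi
      have := (iSupIndep_iff_finsetSum_eq_zero_imp_eq_zero _).1 hG.1 s (fun i => (v i : V))
        (fun i hi => hv i hi) (by
          have := congrArg W.carrier.subtype h0
          simpa using this) i hi
      exact Subtype.ext this
    · apply Submodule.map_injective_of_injective W.carrier.subtype_injective
      rw [Submodule.map_iSup, Submodule.map_top, Submodule.range_subtype]
      simp only [Submodule.map_comap_subtype]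
      exact le_antisymm (iSup_le fun d => inf_le_left) W.graded

/-- A graded Lie subalgebra is itself a graded Lie superalgebra. -/
def GradedLieSubalgebra.toLie {k g : Type*} [Field k] [AddCommGroup g] [Module k g]
    {L : GradedLieSuperalgebra k g} (H : GradedLieSubalgebra L) :
    GradedLieSuperalgebra k H.carrier where
  toGradedSuperspace := H.toGradedSubspace.toSuperspace
  bracket := LinearMap.mk₂ k (fun x y => ⟨L.bracket x y, H.bracket_mem x.2 y.2⟩)
    (fun _ _ _ => Subtype.ext (by simp)) (fun _ _ _ => Subtype.ext (by simp))
    (fun _ _ _ => Subtype.ext (by simp)) (fun _ _ _ => Subtype.ext (by simp))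
  bracket_mem hx hy := L.bracket_mem hx hy
  skew hx hy := Subtype.ext (L.skew hx hy)
  jacobi hx hy hz := Subtype.ext (L.jacobi hx hy hz)

/-- The abelian graded Lie superalgebra on a graded superspace: all brackets vanish. -/
def GradedSuperspace.abelian {k V : Type*} [Field k] [AddCommGroup V] [Module k V]
    (G : GradedSuperspace k V) : GradedLieSuperalgebra k V where
  toGradedSuperspace := G
  bracket := 0
  bracket_mem _ _ := by simp
  skew _ _ := by simp
  jacobi _ _ _ := by simp

namespace GradedLieSuperalgebra

variable {k g : Type*} [Field k] [AddCommGroup g] [Module k g] (L : GradedLieSuperalgebra k g)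

/-- The defining relations `x ⊗ y = (-1) ^ (p(x) p(y)) y ⊗ x + [x, y]` (for homogeneous `x`, `y`)
of the universal enveloping algebra. -/
inductive Rel : TensorAlgebra k g → TensorAlgebra k g → Prop
  | of {i j : Bideg} {x y : g} (hx : x ∈ L.comp i) (hy : y ∈ L.comp j) :
    Rel (TensorAlgebra.ι k x * TensorAlgebra.ι k y)
      (koszulSign i j • (TensorAlgebra.ι k y * TensorAlgebra.ι k x) +
        TensorAlgebra.ι k (L.bracket x y))

/-- The universal enveloping algebra `U(g)`: the quotient of the tensor algebra of `g` by the
two-sided ideal generated by `x ⊗ y - (-1) ^ (p(x) p(y)) y ⊗ x - [x, y]`. -/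
def U : Type _ := RingQuot L.Rel

instance : Ring L.U := inferInstanceAs (Ring (RingQuot L.Rel))
instance : Algebra k L.U := inferInstanceAs (Algebra k (RingQuot L.Rel))

/-- The canonical map `g → U(g)`. -/
def ι : g →ₗ[k] L.U := (RingQuot.mkAlgHom k L.Rel).toLinearMap ∘ₗ TensorAlgebra.ι k

theorem ι_mul_ι {i j : Bideg} {x y : g} (hx : x ∈ L.comp i) (hy : y ∈ L.comp j) :
    L.ι x * L.ι y = koszulSign i j • (L.ι y * L.ι x) + L.ι (L.bracket x y) := by
  have := RingQuot.mkAlgHom_rel k (Rel.of (L := L) hx hy)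
  rw [map_mul, map_add, Units.smul_def, map_zsmul, map_mul] at this
  rw [Units.smul_def]
  exact this

/-- The universal property of `U(g)`. -/
def lift {A : Type*} [Ring A] [Algebra k A] (f : g →ₗ[k] A)
    (hf : ∀ {i j : Bideg} {x y : g}, x ∈ L.comp i → y ∈ L.comp j →
      f x * f y = koszulSign i j • (f y * f x) + f (L.bracket x y)) : L.U →ₐ[k] A :=
  RingQuot.liftAlgHom k ⟨TensorAlgebra.lift k f, by
    rintro _ _ ⟨hx, hy⟩
    rw [map_mul, map_add, Units.smul_def, map_zsmul, map_mul]
    simp only [TensorAlgebra.lift_ι_apply]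
    rw [hf hx hy, Units.smul_def]⟩

@[simp]
theorem lift_ι {A : Type*} [Ring A] [Algebra k A] (f : g →ₗ[k] A)
    (hf : ∀ {i j : Bideg} {x y : g}, x ∈ L.comp i → y ∈ L.comp j →
      f x * f y = koszulSign i j • (f y * f x) + f (L.bracket x y)) (x : g) :
    L.lift f hf (L.ι x) = f x := by
  change RingQuot.liftAlgHom k _ (RingQuot.mkAlgHom k L.Rel (TensorAlgebra.ι k x)) = f x
  rw [RingQuot.liftAlgHom_mkAlgHom_apply, TensorAlgebra.lift_ι_apply]

theorem hom_ext {A : Type*} [Ring A] [Algebra k A] {f f' : L.U →ₐ[k] A}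
    (h : ∀ x, f (L.ι x) = f' (L.ι x)) : f = f' := by
  apply RingQuot.ringQuot_ext'
  apply TensorAlgebra.hom_ext
  ext x
  exact h x

/-- The grading of `U(g)`: the component of bidegree `d` is spanned by the products
`x₁ ⋯ xₙ` of homogeneous elements of `g` whose bidegrees add up to `d`. -/
def grading (d : Bideg) : Submodule k L.U :=
  Submodule.span k {u | ∃ l : List (Bideg × g), (∀ a ∈ l, a.2 ∈ L.comp a.1) ∧
    (l.map Prod.fst).sum = d ∧ u = (l.map fun a => L.ι a.2).prod}

theorem ι_mem {d : Bideg} {x : g} (hx : x ∈ L.comp d) : L.ι x ∈ L.grading d :=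
  Submodule.subset_span ⟨[(d, x)], by simpa using hx, by simp, by simp⟩

instance : SetLike.GradedMonoid L.grading where
  one_mem := Submodule.subset_span ⟨[], by simp, by simp, by simp⟩
  mul_mem i j a b ha hb := by
    have h := Submodule.mul_mem_mul ha hb
    rw [grading, grading, Submodule.span_mul_span] at h
    refine Submodule.span_mono ?_ h
    rintro _ ⟨_, ⟨l, hl, rfl, rfl⟩, _, ⟨l', hl', rfl, rfl⟩, rfl⟩
    refine ⟨l ++ l', ?_, by simp, by simp⟩
    intro a ha
    rcases List.mem_append.1 ha with h | h
    · exact hl a h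
    · exact hl' a h

theorem coe_bijective : Function.Bijective (DirectSum.coeLinearMap L.comp) := L.isInternal

/-- The canonical map `g → U(g)`, seen componentwise. -/
def ιGraded : g →ₗ[k] ⨁ d, L.grading d :=
  (DirectSum.toModule k Bideg _ fun d =>
    DirectSum.lof k Bideg (fun d => L.grading d) d ∘ₗ
      (L.ι.restrict fun _ hx => L.ι_mem hx : L.comp d →ₗ[k] L.grading d)) ∘ₗ
    (LinearEquiv.ofBijective (DirectSum.coeLinearMap L.comp) L.coe_bijective).symm.toLinearMap

theorem ιGraded_of_mem {d : Bideg} {x : g} (hx : x ∈ L.comp d) :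
    L.ιGraded x = DirectSum.of (fun d => L.grading d) d ⟨L.ι x, L.ι_mem hx⟩ := by
  have : (LinearEquiv.ofBijective (DirectSum.coeLinearMap L.comp) L.coe_bijective).symm x =
      DirectSum.lof k Bideg (fun d => L.comp d) d ⟨x, hx⟩ := by
    rw [LinearEquiv.symm_apply_eq, LinearEquiv.ofBijective_apply, DirectSum.coeLinearMap_lof]
  simp only [ιGraded, LinearMap.comp_apply, LinearEquiv.coe_coe, this, DirectSum.toModule_lof]
  rfl

theorem of_smul_eq {d : Bideg} (s : ℤˣ) (a : L.grading d) :
    DirectSum.of (fun d => L.grading d) d (s • a) =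
      s • DirectSum.of (fun d => L.grading d) d a := by
  rw [Units.smul_def, Units.smul_def, map_zsmul]

theorem comp_hom_ext {M : Type*} [AddCommGroup M] [Module k M] {f f' : g →ₗ[k] M}
    (h : ∀ (d : Bideg) (x : g), x ∈ L.comp d → f x = f' x) : f = f' := by
  ext x
  have hx : x ∈ ⨆ d, L.comp d := L.isInternal.submodule_iSup_eq_top ▸ Submodule.mem_top
  induction hx using Submodule.iSup_induction' with
  | mem d x hx => exact h d x hx
  | zero => simp
  | add x y _ _ hx hy => rw [map_add, map_add, hx, hy]

theorem ιGraded_mul {i j : Bideg} {x y : g} (hx : x ∈ L.comp i) (hy : y ∈ L.comp j) :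
    L.ιGraded x * L.ιGraded y =
      koszulSign i j • (L.ιGraded y * L.ιGraded x) + L.ιGraded (L.bracket x y) := by
  have e : L.ιGraded y * L.ιGraded x = DirectSum.of (fun d => L.grading d) (i + j)
      ⟨L.ι y * L.ι x, add_comm j i ▸ SetLike.mul_mem_graded (L.ι_mem hy) (L.ι_mem hx)⟩ := by
    rw [L.ιGraded_of_mem hx, L.ιGraded_of_mem hy, DirectSum.of_mul_of]
    exact DirectSum.of_eq_of_gradedMonoid_eq (Sigma.subtype_ext (add_comm j i) rfl)
  rw [e, L.ιGraded_of_mem hx, L.ιGraded_of_mem hy, L.ιGraded_of_mem (L.bracket_mem hx hy),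
    DirectSum.of_mul_of, ← of_smul_eq, ← map_add]
  congr 1
  exact Subtype.ext (L.ι_mul_ι hx hy)

/-- The canonical map from `U(g)` to the direct sum of its components. -/
def liftGraded : L.U →ₐ[k] ⨁ d, L.grading d :=
  L.lift (A := ⨁ d, L.grading d) L.ιGraded fun hx hy => L.ιGraded_mul hx hy

/-- `U(g)` is a graded algebra. -/
instance gradedAlgebra : GradedAlgebra L.grading :=
  GradedAlgebra.ofAlgHom L.grading L.liftGraded
    (by
      apply L.hom_ext
      intro x
      refine LinearMap.congr_fun (f := (DirectSum.coeAlgHom L.grading).toLinearMap ∘ₗ L.ιGraded)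
        (g := L.ι) (L.comp_hom_ext fun d x hx => ?_) x |> (Eq.trans (by simp [liftGraded]))
      simp [L.ιGraded_of_mem hx])
    (by
      rintro d ⟨u, hu⟩
      induction hu using Submodule.span_induction with
      | mem u hu =>
        obtain ⟨l, hl, rfl, rfl⟩ := hu
        induction l with
        | nil => simp; rfl
        | cons a l ih =>
          have ih' := ih (fun b hb => hl b (List.mem_cons_of_mem a hb))
          have ha := hl a (List.mem_cons_self ..)
          simp only [List.map_cons, List.prod_cons, map_mul] at ih' ⊢
          rw [ih', liftGraded, lift_ι, L.ιGraded_of_mem ha, DirectSum.of_mul_of]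
          exact DirectSum.of_eq_of_gradedMonoid_eq (Sigma.subtype_ext List.sum_cons.symm rfl)
      | zero =>
        rw [map_zero]
        exact (map_zero (DirectSum.of (fun d => L.grading d) d)).symm
      | add x y hx hy ihx ihy =>
        simp only [map_add, ihx, ihy]
        rw [← map_add]; rfl
      | smul c x hx ihx =>
        simp only [map_smul, ihx]
        exact ((DirectSum.lof k Bideg (fun d => L.grading d) d).map_smul c _).symm)

/-- The map `x ↦ x ⊗ 1 + 1 ⊗ x` from `g` to the superalgebra `U(g) ⊗ U(g)`, whose product is
`(a ⊗ b)(a' ⊗ b') = (-1) ^ (p(b) p(a')) aa' ⊗ bb'`. -/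
def primitive : g →ₗ[k] (L.grading ᵍ⊗[k] L.grading) :=
  (GradedTensorProduct.includeLeft L.grading L.grading).toLinearMap ∘ₗ L.ι +
    (GradedTensorProduct.includeRight L.grading L.grading).toLinearMap ∘ₗ L.ι

theorem primitive_mul {i j : Bideg} {x y : g} (hx : x ∈ L.comp i) (hy : y ∈ L.comp j) :
    L.primitive x * L.primitive y =
      koszulSign i j • (L.primitive y * L.primitive x) + L.primitive (L.bracket x y) := by
  have h1 := GradedTensorProduct.tmul_coe_mul_coe_tmul (R := k) L.grading L.grading 1
    ⟨L.ι x, L.ι_mem hx⟩ ⟨L.ι y, L.ι_mem hy⟩ 1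
  have h2 := GradedTensorProduct.tmul_coe_mul_coe_tmul (R := k) L.grading L.grading 1
    ⟨L.ι y, L.ι_mem hy⟩ ⟨L.ι x, L.ι_mem hx⟩ 1
  have h3 := GradedTensorProduct.tmul_one_mul_one_tmul (R := k) L.grading L.grading
    (L.ι x) (L.ι y)
  have h4 := GradedTensorProduct.tmul_one_mul_one_tmul (R := k) L.grading L.grading
    (L.ι y) (L.ι x)
  have h5 := congrArg (GradedTensorProduct.includeLeft L.grading L.grading) (L.ι_mul_ι hx hy)
  have h6 := congrArg (GradedTensorProduct.includeRight L.grading L.grading) (L.ι_mul_ι hx hy)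
  rw [Units.smul_def, map_add, map_zsmul, map_mul, map_mul] at h5 h6
  rw [uzpow_bideg] at h1 h2
  have hs : koszulSign j i = koszulSign i j := by rw [koszulSign, koszulSign, mul_comm]
  rw [hs] at h2
  simp only [one_mul, mul_one] at h1 h2
  simp only [primitive, LinearMap.add_apply, LinearMap.comp_apply, AlgHom.toLinearMap_apply,
    mul_add, add_mul, h5, h6, Units.smul_def]
  simp only [GradedTensorProduct.includeLeft_apply, GradedTensorProduct.includeRight_apply]
  rw [h1, h2, h3, h4, Units.smul_def, smul_add, smul_add, smul_add]
  have hss : ((koszulSign i j : ℤˣ) : ℤ) * ((koszulSign i j : ℤˣ) : ℤ) = 1 := by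
    rw [← Units.val_mul, Int.units_mul_self, Units.val_one]
  simp only [Units.smul_def, smul_smul, hss, one_smul]
  abel

/-- The comultiplication of `U(g)` as a map of superalgebras `U(g) → U(g) ⊗ U(g)`: it is determined
by `x ↦ x ⊗ 1 + 1 ⊗ x` for `x ∈ g`. -/
def comulAlgHom : L.U →ₐ[k] (L.grading ᵍ⊗[k] L.grading) :=
  L.lift (A := L.grading ᵍ⊗[k] L.grading) L.primitive fun hx hy => L.primitive_mul hx hy

@[simp]
theorem comulAlgHom_ι (x : g) : L.comulAlgHom (L.ι x) = L.primitive x :=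
  L.lift_ι (A := L.grading ᵍ⊗[k] L.grading) _ _ x

/-- The counit of `U(g)`: the algebra map which kills `g`. -/
def counitAlgHom : L.U →ₐ[k] k := L.lift 0 (by intros; simp)

/-- The coalgebra structure of `U(g)`. -/
instance : CoalgebraStruct k L.U where
  comul := (GradedTensorProduct.of k L.grading L.grading).symm.toLinearMap ∘ₗ
    L.comulAlgHom.toLinearMap
  counit := L.counitAlgHom.toLinearMap

end GradedLieSuperalgebra

/-- The algebra map `U(h) → U(g)` induced by the inclusion of a graded Lie subalgebra. -/
def GradedLieSubalgebra.incl {k g : Type*} [Field k] [AddCommGroup g] [Module k g]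
    {L : GradedLieSuperalgebra k g} (H : GradedLieSubalgebra L) : H.toLie.U →ₐ[k] L.U :=
  H.toLie.lift (L.ι ∘ₗ H.carrier.subtype) fun hx hy => L.ι_mul_ι hx hy

/-- `U(g)` is a left `U(h)`-module, `a` acting as left multiplication by its image in `U(g)`. -/
instance GradedLieSubalgebra.moduleU {k g : Type*} [Field k] [AddCommGroup g] [Module k g]
    {L : GradedLieSuperalgebra k g} (H : GradedLieSubalgebra L) : Module H.toLie.U L.U :=
  Module.compHom L.U H.incl.toRingHom

namespace GradedSuperspace

variable {k V : Type*} [Field k] [AddCommGroup V] [Module k V] (G : GradedSuperspace k V)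

/-- The graded symmetric algebra `Sym(V)`, together with its grading and its coalgebra structure:
the quotient of the tensor algebra by `x ⊗ y - (-1) ^ (p(x) p(y)) y ⊗ x`, which is the enveloping
algebra for the zero bracket. Its product is written `⊙` on paper and `*` here. -/
abbrev Sym : Type _ := G.abelian.U

/-- The components of `Sym(V)`. -/
abbrev symGrading : Bideg → Submodule k G.Sym := G.abelian.grading

/-- The canonical map `V → Sym(V)`. -/
abbrev symι : V →ₗ[k] G.Sym := G.abelian.ι

end GradedSuperspace

section GradedTensor

variable {k A B : Type*} [Field k] [Ring A] [Ring B] [Algebra k A] [Algebra k B]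
  (𝒜 : Bideg → Submodule k A) (ℬ : Bideg → Submodule k B) [GradedAlgebra 𝒜] [GradedAlgebra ℬ]

/-- The braiding `a ⊗ b ↦ (-1) ^ (p(a) p(b)) b ⊗ a`. -/
def superSwap : A ⊗[k] B ≃ₗ[k] B ⊗[k] A :=
  GradedTensorProduct.of k 𝒜 ℬ ≪≫ₗ (GradedTensorProduct.comm 𝒜 ℬ).toLinearEquiv ≪≫ₗ
    (GradedTensorProduct.of k ℬ 𝒜).symm

/-- The map `(a ⊗ a') ⊗ (b ⊗ b') ↦ (-1) ^ (p(a') p(b)) (a ⊗ b) ⊗ (a' ⊗ b')`. -/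
def superMiddleSwap : (A ⊗[k] A) ⊗[k] (B ⊗[k] B) ≃ₗ[k] (A ⊗[k] B) ⊗[k] (A ⊗[k] B) :=
  TensorProduct.assoc k A A (B ⊗[k] B) ≪≫ₗ
    (TensorProduct.congr (LinearEquiv.refl k A)
      ((TensorProduct.assoc k A B B).symm ≪≫ₗ
        TensorProduct.congr (superSwap 𝒜 ℬ) (LinearEquiv.refl k B) ≪≫ₗ
        TensorProduct.assoc k B A B)) ≪≫ₗ
    (TensorProduct.assoc k A B (A ⊗[k] B)).symm

/-- The tensor product of two graded coalgebras:
`Δ(a ⊗ b) = ∑ (-1) ^ (p(a₂) p(b₁)) (a₁ ⊗ b₁) ⊗ (a₂ ⊗ b₂)` and `ε(a ⊗ b) = ε(a) ε(b)`. -/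
instance gradedTensorCoalgebra [CoalgebraStruct k A] [CoalgebraStruct k B] :
    CoalgebraStruct k (𝒜 ᵍ⊗[k] ℬ) where
  comul :=
    (TensorProduct.congr (GradedTensorProduct.of k 𝒜 ℬ)
        (GradedTensorProduct.of k 𝒜 ℬ)).toLinearMap ∘ₗ
      (superMiddleSwap 𝒜 ℬ).toLinearMap ∘ₗ
      TensorProduct.map CoalgebraStruct.comul CoalgebraStruct.comul ∘ₗ
      (GradedTensorProduct.of k 𝒜 ℬ).symm.toLinearMap
  counit :=
    LinearMap.mul' k k ∘ₗ
      TensorProduct.map CoalgebraStruct.counit CoalgebraStruct.counit ∘ₗ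
      (GradedTensorProduct.of k 𝒜 ℬ).symm.toLinearMap

/-- The left `A`-module structure `a • (a' ⊗ b) = aa' ⊗ b` on `A ⊗ B`. -/
instance gradedTensorLeftModule : Module A (𝒜 ᵍ⊗[k] ℬ) :=
  inferInstanceAs (Module A (A ⊗[k] B))

end GradedTensor

end

/-!
The map `φ` is `j ⋆ S`, where `S : Sym(m) → U(g)` is symmetrization. In the convolution algebra of
maps `Sym(m) → U(g)`, the map `S` is the exponential of the projection `Sym(m) → m → U(g)`. In
`U(g) ⊗ U(g)` the elements `x ⊗ 1` and `1 ⊗ y` supercommute, so the exponential of the sum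
`y ↦ y ⊗ 1 + 1 ⊗ y` is the product of two exponentials, which says that `S` respects
comultiplication; as multiplication in `U(g)` is compatible with `Δ`, so does `φ`.

For bijectivity, filter `U(g)` by the length of products. Modulo shorter products,
`φ (x₁ ⋯ xₘ ⊗ y₁ ⊙ ⋯ ⊙ yₙ)` is `x₁ ⋯ xₘ y₁ ⋯ yₙ`, and letters can be reordered up to sign; hence
`φ` is surjective. For injectivity one needs the Poincaré–Birkhoff–Witt theorem in the form of a map
`U(g) → Sym(g)` which preserves leading terms: composing it with the comultiplication of `Sym(g)`
and the projections to `h` and `m`, then symmetrizing `Sym(h) → U(h)`, gives a left inverse of `φ`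
up to terms of lower length.

That map is built by induction on the length `n` of words. Its possible values on the words of
length `n`, given those on shorter tensors, are the common fixed points of affine maps which swap
two adjacent letters and correct by their bracket. Skew symmetry makes these maps involutions, and
the Jacobi identity gives the braid relation, so they generate an affine action of the symmetric
group; in characteristic `0`, averaging over it produces a fixed point.
-/

noncomputable section

/-! ### Words and the length filtration -/

section Signs

variable (k : Type*) [Ring k]

/-- The Koszul sign as a scalar, so that it can be moved around by the module axioms. -/
def ksign (i j : Bideg) : k := ((koszulSign i j : ℤ) : k)

variable {k} in
theorem intCast_units_smul {M : Type*} [AddCommGroup M] [Module k M] (s : ℤˣ) (x : M) :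
    ((s : ℤ) : k) • x = s • x := by
  rw [Units.smul_def, Int.cast_smul_eq_zsmul]

theorem ksign_smul {M : Type*} [AddCommGroup M] [Module k M] (i j : Bideg) (x : M) :
    ksign k i j • x = koszulSign i j • x := intCast_units_smul _ x

theorem koszulSign_comm (i j : Bideg) : koszulSign i j = koszulSign j i := by
  rw [koszulSign, koszulSign, mul_comm]

theorem ksign_comm (i j : Bideg) : ksign k i j = ksign k j i := by
  rw [ksign, ksign, koszulSign_comm]

theorem ksign_mul_self (i j : Bideg) : ksign k i j * ksign k i j = 1 := by
  rw [ksign, ← Int.cast_mul, ← Units.val_mul, Int.units_mul_self, Units.val_one, Int.cast_one]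

theorem ksign_add_left (i i' j : Bideg) : ksign k (i + i') j = ksign k i j * ksign k i' j := by
  simp only [ksign, koszulSign, Prod.snd_add, add_mul, uzpow_add, Units.val_mul, Int.cast_mul]

theorem ksign_add_right (i j j' : Bideg) : ksign k i (j + j') = ksign k i j * ksign k i j' := by
  simp only [ksign_comm k i, ksign_add_left]

theorem ksign_zero_right (i : Bideg) : ksign k i 0 = 1 := by simp [ksign, koszulSign]

theorem ksign_zero_left (i : Bideg) : ksign k 0 i = 1 := by
  rw [ksign_comm, ksign_zero_right]

end Signs

namespace GradedLieSuperalgebra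

variable {k g : Type*} [Field k] [AddCommGroup g] [Module k g] {L : GradedLieSuperalgebra k g}

theorem bracket_skew {i j : Bideg} {x y : g} (hx : x ∈ L.comp i) (hy : y ∈ L.comp j) :
    L.bracket x y = -(ksign k i j • L.bracket y x) := by
  rw [ksign_smul, L.skew hx hy]

theorem bracket_jacobi {i j l : Bideg} {x y z : g} (hx : x ∈ L.comp i) (hy : y ∈ L.comp j)
    (hz : z ∈ L.comp l) : L.bracket x (L.bracket y z) =
      L.bracket (L.bracket x y) z + ksign k i j • L.bracket y (L.bracket x z) := by
  rw [ksign_smul, L.jacobi hx hy hz]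

theorem ι_mul_ι_eq {i j : Bideg} {x y : g} (hx : x ∈ L.comp i) (hy : y ∈ L.comp j) :
    L.ι x * L.ι y = ksign k i j • (L.ι y * L.ι x) + L.ι (L.bracket x y) := by
  rw [ksign_smul, L.ι_mul_ι hx hy]

variable (L)

/-- A list of elements of `g`, each homogeneous of the bidegree recorded with it. -/
def IsHomog (l : List (Bideg × g)) : Prop := ∀ a ∈ l, a.2 ∈ L.comp a.1

/-- The product in `U(g)` of a list of elements of `g`, whose recorded bidegrees are ignored. -/
def prodι (l : List (Bideg × g)) : L.U := (l.map fun a => L.ι a.2).prod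

variable {L}

theorem isHomog_nil : L.IsHomog [] := by simp [IsHomog]

theorem isHomog_cons {a : Bideg × g} {l : List (Bideg × g)} :
    L.IsHomog (a :: l) ↔ a.2 ∈ L.comp a.1 ∧ L.IsHomog l := by simp [IsHomog]

theorem isHomog_append {l l' : List (Bideg × g)} :
    L.IsHomog (l ++ l') ↔ L.IsHomog l ∧ L.IsHomog l' := by
  simp [IsHomog, or_imp, forall_and]

theorem IsHomog.perm {l l' : List (Bideg × g)} (hl : L.IsHomog l) (h : l.Perm l') :
    L.IsHomog l' := fun a ha => hl a (h.mem_iff.2 ha)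

variable (L)

@[simp] theorem prodι_nil : L.prodι [] = 1 := rfl

@[simp] theorem prodι_cons (a : Bideg × g) (l : List (Bideg × g)) :
    L.prodι (a :: l) = L.ι a.2 * L.prodι l := by simp [prodι]

@[simp] theorem prodι_append (l l' : List (Bideg × g)) :
    L.prodι (l ++ l') = L.prodι l * L.prodι l' := by simp [prodι]

theorem prodι_mem_grading {l : List (Bideg × g)} (hl : L.IsHomog l) :
    L.prodι l ∈ L.grading (l.map Prod.fst).sum :=
  Submodule.subset_span ⟨l, hl, rfl, rfl⟩

theorem span_prodι : Submodule.span k (L.prodι '' {l | L.IsHomog l}) = ⊤ := by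
  rw [eq_top_iff, ← (DirectSum.Decomposition.isInternal L.grading).submodule_iSup_eq_top]
  refine iSup_le fun d => Submodule.span_mono ?_
  rintro _ ⟨l, hl, -, rfl⟩
  exact ⟨l, hl, rfl⟩

theorem linearMap_ext_prodι {M : Type*} [AddCommGroup M] [Module k M] {f f' : L.U →ₗ[k] M}
    (h : ∀ l, L.IsHomog l → f (L.prodι l) = f' (L.prodι l)) : f = f' :=
  LinearMap.ext_on L.span_prodι (by rintro _ ⟨l, hl, rfl⟩; exact h l hl)

theorem linearMap_ext_ι_mul {M : Type*} [AddCommGroup M] [Module k M] {f f' : L.U →ₗ[k] M}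
    (h1 : f 1 = f' 1)
    (h : ∀ (d : Bideg) (x : g) (a : L.U), x ∈ L.comp d → f a = f' a →
      f (L.ι x * a) = f' (L.ι x * a)) : f = f' := by
  refine L.linearMap_ext_prodι fun l hl => ?_
  induction l with
  | nil => exact h1
  | cons a l ih =>
    rw [isHomog_cons] at hl
    rw [prodι_cons]
    exact h a.1 a.2 _ hl.1 (ih hl.2)

/-- The word length filtration of `U(g)`: the span of the products of fewer than `n` homogeneous
elements of `g`. The strict bound makes `filLT 0 = ⊥`, so that "up to shorter products" is
expressed by membership in `filLT` of the length, also for the empty product. -/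
def filLT (n : ℕ) : Submodule k L.U :=
  Submodule.span k (L.prodι '' {l | L.IsHomog l ∧ l.length < n})

theorem filLT_zero : L.filLT 0 = ⊥ := by simp [filLT]

theorem prodι_mem_filLT {l : List (Bideg × g)} (hl : L.IsHomog l) {n : ℕ} (hn : l.length < n) :
    L.prodι l ∈ L.filLT n := Submodule.subset_span ⟨l, ⟨hl, hn⟩, rfl⟩

theorem filLT_le_iff {n : ℕ} {W : Submodule k L.U} :
    L.filLT n ≤ W ↔ ∀ l, L.IsHomog l → l.length < n → L.prodι l ∈ W := by
  rw [filLT, Submodule.span_le, Set.image_subset_iff]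
  exact ⟨fun h l hl hn => h ⟨hl, hn⟩, fun h l hl => h l hl.1 hl.2⟩

theorem filLT_mono : Monotone L.filLT := fun _ _ h =>
  L.filLT_le_iff.2 fun _ hl hn => L.prodι_mem_filLT hl (hn.trans_le h)

theorem mul_mem_filLT {m n N : ℕ} {a b : L.U} (ha : a ∈ L.filLT m) (hb : b ∈ L.filLT n)
    (h : m + n ≤ N + 1) : a * b ∈ L.filLT N := by
  have hab := Submodule.mul_mem_mul ha hb
  rw [filLT, filLT, Submodule.span_mul_span] at hab
  refine Submodule.span_mono ?_ hab
  rintro _ ⟨_, ⟨l, ⟨hl, hm⟩, rfl⟩, _, ⟨l', ⟨hl', hn⟩, rfl⟩, rfl⟩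
  exact ⟨l ++ l', ⟨isHomog_append.2 ⟨hl, hl'⟩, by rw [List.length_append]; omega⟩, by simp⟩

theorem iSup_filLT : ⨆ n, L.filLT n = ⊤ := by
  rw [eq_top_iff, ← L.span_prodι, Submodule.span_le]
  rintro _ ⟨l, hl, rfl⟩
  exact Submodule.mem_iSup_of_mem (l.length + 1) (L.prodι_mem_filLT hl (Nat.lt_succ_self _))

theorem exists_mem_filLT (u : L.U) : ∃ n, u ∈ L.filLT n := by
  rw [← Submodule.mem_iSup_of_directed _ L.filLT_mono.directed_le, iSup_filLT]
  trivial

theorem iSup_comp : ⨆ d, L.comp d = ⊤ := L.isInternal.submodule_iSup_eq_top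

theorem ι_mem_filLT (x : g) : L.ι x ∈ L.filLT 2 := by
  suffices h : ⨆ d, L.comp d ≤ (L.filLT 2).comap L.ι from h (L.iSup_comp ▸ Submodule.mem_top)
  refine iSup_le fun d x hx => ?_
  simpa using L.prodι_mem_filLT (l := [(d, x)]) (isHomog_cons.2 ⟨hx, isHomog_nil⟩) one_lt_two

theorem ι_mul_mem_filLT (x : g) {n : ℕ} {a : L.U} (ha : a ∈ L.filLT n) :
    L.ι x * a ∈ L.filLT (n + 1) :=
  L.mul_mem_filLT (L.ι_mem_filLT x) ha (by omega)

theorem mul_sub_mul_mem_filLT {m n : ℕ} {a a' b b' : L.U} (hb : b ∈ L.filLT (n + 1))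
    (ha' : a' ∈ L.filLT (m + 1)) (haa' : a - a' ∈ L.filLT m) (hbb' : b - b' ∈ L.filLT n) :
    a * b - a' * b' ∈ L.filLT (m + n) := by
  have : a * b - a' * b' = (a - a') * b + a' * (b - b') := by noncomm_ring
  rw [this]
  exact add_mem (L.mul_mem_filLT haa' hb (by omega)) (L.mul_mem_filLT ha' hbb' (by omega))

theorem ksign_smul_ι_mul_ι_mul_sub_mem_filLT {i j : Bideg} {x y : g} (hx : x ∈ L.comp i)
    (hy : y ∈ L.comp j) {n : ℕ} {a : L.U} (ha : a ∈ L.filLT (n + 1)) :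
    ksign k i j • (L.ι x * (L.ι y * a)) - L.ι y * (L.ι x * a) ∈ L.filLT (n + 2) := by
  have : ksign k i j • (L.ι x * (L.ι y * a)) - L.ι y * (L.ι x * a) =
      ksign k i j • (L.ι (L.bracket x y) * a) := by
    rw [← mul_assoc, ι_mul_ι_eq hx hy, add_mul, smul_add, smul_mul_assoc, smul_smul,
      ksign_mul_self, one_smul, mul_assoc]
    abel
  rw [this]
  exact Submodule.smul_mem _ _ (L.ι_mul_mem_filLT _ ha)

theorem exists_prodι_sub_smul_prodι_mem_filLT {l l' : List (Bideg × g)} (h : l.Perm l')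
    (hl : L.IsHomog l) : ∃ c : k, L.prodι l - c • L.prodι l' ∈ L.filLT l.length := by
  induction h with
  | nil => exact ⟨1, by simp⟩
  | cons a _ ih =>
    rw [isHomog_cons] at hl
    obtain ⟨c, hc⟩ := ih hl.2
    refine ⟨c, ?_⟩
    rw [prodι_cons, prodι_cons, ← mul_smul_comm, ← mul_sub]
    exact L.ι_mul_mem_filLT _ hc
  | swap a b l =>
    rw [isHomog_cons, isHomog_cons] at hl
    refine ⟨ksign k a.1 b.1, ?_⟩
    rw [← neg_mem_iff, neg_sub]
    simpa using L.ksign_smul_ι_mul_ι_mul_sub_mem_filLT hl.2.1 hl.1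
      (L.prodι_mem_filLT hl.2.2 (Nat.lt_succ_self _))
  | @trans l l' l'' h _ ih ih' =>
    obtain ⟨c, hc⟩ := ih hl
    obtain ⟨c', hc'⟩ := ih' (hl.perm h)
    refine ⟨c * c', ?_⟩
    rw [← h.length_eq] at hc'
    have : L.prodι l - (c * c') • L.prodι l'' =
      (L.prodι l - c • L.prodι l') + c • (L.prodι l' - c' • L.prodι l'') := by module
    rw [this]
    exact add_mem hc (Submodule.smul_mem _ _ hc')

end GradedLieSuperalgebra

/-! ### Coxeter relations and fixed points -/

section CommonFixedPoint

/-- The maps `σ 0, …, σ (n - 1)` satisfy the Coxeter relations of the simple transpositions of the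
symmetric group on `n + 1` letters. -/
structure SatisfiesCoxeterRelations {X : Type*} (σ : ℕ → X → X) (n : ℕ) : Prop where
  involutive : ∀ i < n, Function.Involutive (σ i)
  comm : ∀ i j, i + 1 < j → j < n → ∀ x, σ i (σ j x) = σ j (σ i x)
  braid : ∀ i, i + 1 < n → ∀ x, σ i (σ (i + 1) (σ i x)) = σ (i + 1) (σ i (σ (i + 1) x))

namespace SatisfiesCoxeterRelations

variable {X : Type*} {σ : ℕ → X → X} {m : ℕ} {u : ℕ → X}

theorem apply_eq_self_of_add_one_lt (hσ : SatisfiesCoxeterRelations σ (m + 1))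
    (hu : ∀ j ≤ m, u j = σ j (u (j + 1))) (hm : ∀ i < m, σ i (u (m + 1)) = u (m + 1)) {i j : ℕ}
    (hij : i + 1 < j) (hj : j ≤ m + 1) : σ i (u j) = u j := by
  induction hj using Nat.decreasingInduction with
  | self => exact hm i (by omega)
  | of_succ j hj ih => rw [hu j (by omega), hσ.comm i j hij hj, ih (by omega)]

theorem apply_eq_self_of_lt (hσ : SatisfiesCoxeterRelations σ (m + 1))
    (hu : ∀ j ≤ m, u j = σ j (u (j + 1))) (hm : ∀ i < m, σ i (u (m + 1)) = u (m + 1)) {i j : ℕ}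
    (hji : j < i) (hi : i ≤ m) : σ i (u j) = u j := by
  obtain ⟨i, rfl⟩ : ∃ i', i = i' + 1 := ⟨i - 1, by omega⟩
  induction Nat.le_of_lt_succ hji using Nat.decreasingInduction with
  | self =>
    rw [hu i (by omega), hu (i + 1) hi, ← hσ.braid i (by omega),
      hσ.apply_eq_self_of_add_one_lt hu hm (lt_add_one (i + 1)) (by omega)]
  | of_succ j hj ih =>
    rw [hu j (by omega), ← hσ.comm j (i + 1) (by omega) (by omega), ih (by omega)]

theorem apply_eq_swap (hσ : SatisfiesCoxeterRelations σ (m + 1))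
    (hu : ∀ j ≤ m, u j = σ j (u (j + 1))) (hm : ∀ i < m, σ i (u (m + 1)) = u (m + 1)) {i j : ℕ}
    (hi : i ≤ m) (hj : j ≤ m + 1) : σ i (u j) = u (Equiv.swap i (i + 1) j) := by
  rcases lt_trichotomy j i with h | rfl | h
  · rw [Equiv.swap_apply_of_ne_of_ne (by omega) (by omega), hσ.apply_eq_self_of_lt hu hm h hi]
  · rw [Equiv.swap_apply_left, hu j hi, hσ.involutive j (by omega)]
  rcases eq_or_ne j (i + 1) with rfl | h'
  · rw [Equiv.swap_apply_right, hu i hi]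
  · rw [Equiv.swap_apply_of_ne_of_ne (by omega) h',
      hσ.apply_eq_self_of_add_one_lt hu hm (by omega) hj]

end SatisfiesCoxeterRelations

variable {k V X : Type*} [DivisionRing k] [CharZero k] [AddCommGroup V] [Module k V]
  [AddTorsor V X]

/- If `x` is fixed by `σ 0, …, σ (m - 1)`, then `σ 0, …, σ m` permute the points
`u j = σ j (σ (j + 1) (⋯ (σ m x)))`, one for each coset of the subgroup generated by
`σ 0, …, σ (m - 1)`, and hence fix their centroid. -/
theorem SatisfiesCoxeterRelations.exists_mem_fixed_succ {σ : ℕ → X →ᵃ[k] X} {m : ℕ}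
    (hσ : SatisfiesCoxeterRelations (fun i => σ i) (m + 1)) {N : AffineSubspace k X}
    (hN : ∀ i ≤ m, ∀ x ∈ N, σ i x ∈ N) {x : X} (hxN : x ∈ N) (hx : ∀ i < m, σ i x = x) :
    ∃ y ∈ N, ∀ i ≤ m, σ i y = y := by
  let u : ℕ → X := fun j => (List.range' j (m + 1 - j)).foldr (fun i => σ i) x
  have hu : ∀ j ≤ m, u j = σ j (u (j + 1)) := fun j hj => by
    simp only [u]
    rw [show m + 1 - j = m + 1 - (j + 1) + 1 by omega, List.range'_succ, List.foldr_cons]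
  have hum : u (m + 1) = x := by simp [u]
  have huN : ∀ j, u j ∈ N := fun j => by
    rcases le_total (m + 1) j with hj | hj
    · simpa [u, Nat.sub_eq_zero_of_le hj] using hxN
    induction hj using Nat.decreasingInduction with
    | self => rwa [hum]
    | of_succ j hj ih => rw [hu j (by omega)]; exact hN j (by omega) _ ih
  have hspan : affineSpan k (Set.range u) ≤ N := affineSpan_le.2 (Set.range_subset_iff.2 huN)
  have hne : (Finset.range (m + 2)).Nonempty := Finset.nonempty_range_iff.2 (by omega)
  refine ⟨(Finset.range (m + 2)).centroid k u,
    hspan (centroid_mem_affineSpan_of_nonempty k u hne), fun i hi => ?_⟩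
  have hperm : (Finset.range (m + 2)).map (Equiv.swap i (i + 1)).toEmbedding =
      Finset.range (m + 2) := Finset.map_perm fun j hj => by
    have := (Equiv.swap_apply_ne_self_iff.1 hj).2
    simp only [Finset.coe_range, Set.mem_Iio]
    omega
  calc σ i ((Finset.range (m + 2)).centroid k u)
      = (Finset.range (m + 2)).centroid k (σ i ∘ u) := by
        rw [Finset.centroid_def, Finset.map_affineCombination _ _ _
          (Finset.sum_centroidWeights_eq_one_of_nonempty k _ hne), Finset.centroid_def]
    _ = (Finset.range (m + 2)).centroid k (u ∘ Equiv.swap i (i + 1)) :=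
        Finset.affineCombination_congr _ (fun _ _ => rfl) fun j hj =>
          hσ.apply_eq_swap hu (by simpa only [hum] using hx) hi
            (Nat.lt_succ_iff.1 (Finset.mem_range.1 hj))
    _ = (Finset.range (m + 2)).centroid k u := by
        conv_rhs => rw [← hperm, Finset.centroid_map]
        rfl

theorem SatisfiesCoxeterRelations.exists_mem_fixed {σ : ℕ → X →ᵃ[k] X} {n : ℕ}
    (hσ : SatisfiesCoxeterRelations (fun i => σ i) n) {N : AffineSubspace k X}
    (hN : ∀ i < n, ∀ x ∈ N, σ i x ∈ N) (hN' : (N : Set X).Nonempty) :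
    ∃ x ∈ N, ∀ i < n, σ i x = x := by
  induction n with
  | zero => exact hN'.imp fun x hx => ⟨hx, by simp⟩
  | succ n ih =>
    obtain ⟨x, hxN, hx⟩ := ih ⟨fun i hi => hσ.involutive i (by omega),
      fun i j hij hj => hσ.comm i j hij (by omega), fun i hi => hσ.braid i (by omega)⟩
      fun i hi => hN i (by omega)
    simpa only [Nat.lt_succ_iff] using
      hσ.exists_mem_fixed_succ (fun i hi => hN i (by omega)) hxN hx

end CommonFixedPoint

/-! ### The Poincaré–Birkhoff–Witt map -/

section TensorWords

variable {k g I : Type*} [Field k] [AddCommGroup g] [Module k g]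

variable (k g) in
/-- The degree `n` part of the tensor algebra of `g`. -/
abbrev tensorDeg (n : ℕ) : Submodule k (TensorAlgebra k g) :=
  LinearMap.range (TensorAlgebra.ι k : g →ₗ[k] TensorAlgebra k g) ^ n

theorem ι_mul_mem_tensorDeg {n : ℕ} (x : g) {a : TensorAlgebra k g} (ha : a ∈ tensorDeg k g n) :
    TensorAlgebra.ι k x * a ∈ tensorDeg k g (n + 1) := by
  rw [tensorDeg, pow_succ']
  exact Submodule.mul_mem_mul (LinearMap.mem_range_self _ x) ha

theorem mul_mem_tensorDeg {m n : ℕ} {a b : TensorAlgebra k g} (ha : a ∈ tensorDeg k g m)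
    (hb : b ∈ tensorDeg k g n) : a * b ∈ tensorDeg k g (m + n) :=
  SetLike.mul_mem_graded ha hb

theorem iSup_tensorDeg : ⨆ n, tensorDeg k g n = ⊤ :=
  (DirectSum.Decomposition.isInternal (tensorDeg k g)).submodule_iSup_eq_top

/-- The product in the tensor algebra of a list of basis vectors. -/
def tensorWord (b : Module.Basis I k g) (w : List I) : TensorAlgebra k g :=
  (w.map fun i => TensorAlgebra.ι k (b i)).prod

variable (b : Module.Basis I k g)

@[simp] theorem tensorWord_nil : tensorWord b [] = 1 := rfl

@[simp] theorem tensorWord_cons (i : I) (w : List I) :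
    tensorWord b (i :: w) = TensorAlgebra.ι k (b i) * tensorWord b w := by simp [tensorWord]

@[simp] theorem tensorWord_append (w w' : List I) :
    tensorWord b (w ++ w') = tensorWord b w * tensorWord b w' := by simp [tensorWord]

theorem tensorWord_mem_tensorDeg (w : List I) : tensorWord b w ∈ tensorDeg k g w.length := by
  induction w with
  | nil => exact SetLike.one_mem_graded (tensorDeg k g)
  | cons i w ih => rw [tensorWord_cons, List.length_cons]; exact ι_mul_mem_tensorDeg _ ih

theorem tensorDeg_eq_span (n : ℕ) :
    tensorDeg k g n = Submodule.span k (tensorWord b '' {w | w.length = n}) := by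
  refine le_antisymm ?_ (Submodule.span_le.2 ?_)
  · induction n with
    | zero =>
      rw [tensorDeg, pow_zero, Submodule.one_eq_span]
      exact Submodule.span_mono (Set.singleton_subset_iff.2 ⟨[], rfl, rfl⟩)
    | succ n ih =>
      have hι : LinearMap.range (TensorAlgebra.ι k : g →ₗ[k] TensorAlgebra k g) =
          Submodule.span k (Set.range fun i => TensorAlgebra.ι k (b i)) := by
        rw [LinearMap.range_eq_map, ← b.span_eq, Submodule.map_span, ← Set.range_comp]
        rfl
      rw [tensorDeg, pow_succ']
      refine (mul_le_mul' le_rfl ih).trans ?_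
      rw [hι, Submodule.span_mul_span]
      refine Submodule.span_mono ?_
      rintro _ ⟨_, ⟨i, rfl⟩, _, ⟨w, rfl, rfl⟩, rfl⟩
      exact ⟨i :: w, rfl, tensorWord_cons b i w⟩
  · rintro _ ⟨w, rfl, rfl⟩
    exact tensorWord_mem_tensorDeg b w

theorem basis_tensorAlgebra_apply (w : List I) :
    b.tensorAlgebra (FreeMonoid.ofList w) = tensorWord b w := by
  have h : ∀ w : FreeMonoid I, b.tensorAlgebra w = (TensorAlgebra.equivFreeAlgebra b).symm
      (FreeAlgebra.equivMonoidAlgebraFreeMonoid.symm (MonoidAlgebra.of k _ w)) := fun w => by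
    simp [Module.Basis.tensorAlgebra, FreeAlgebra.basisFreeMonoid]
  rw [h]
  induction w with
  | nil => rw [FreeMonoid.ofList_nil, map_one, map_one, map_one, tensorWord_nil]
  | cons i w ih =>
    rw [FreeMonoid.ofList_cons, map_mul, map_mul, map_mul, ih, tensorWord_cons]
    congr 1
    simp [FreeAlgebra.equivMonoidAlgebraFreeMonoid]

theorem exists_linearMap_tensorWord {S : Type*} [AddCommGroup S] [Module k S] (f : List I → S) :
    ∃ F : TensorAlgebra k g →ₗ[k] S, ∀ w, F (tensorWord b w) = f w :=
  ⟨b.tensorAlgebra.constr k fun w => f (FreeMonoid.toList w), fun w => by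
    rw [← basis_tensorAlgebra_apply, Module.Basis.constr_basis, FreeMonoid.toList_ofList]⟩

end TensorWords

namespace GradedLieSuperalgebra

variable {k g S : Type*} [Field k] [AddCommGroup g] [Module k g] (L : GradedLieSuperalgebra k g)
  [AddCommGroup S] [Module k S]

/-- The element `x ⊗ y - (-1) ^ (p(x) p(y)) y ⊗ x - [x, y]` of the tensor algebra, for `x` and `y`
of bidegrees `i` and `j`. The bidegrees are arguments, so as to make it bilinear in `x` and `y`. -/
def relator (i j : Bideg) : g →ₗ[k] g →ₗ[k] TensorAlgebra k g :=
  (LinearMap.mul k (TensorAlgebra k g)).compl₁₂ (TensorAlgebra.ι k) (TensorAlgebra.ι k) -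
    ksign k i j •
      ((LinearMap.mul k (TensorAlgebra k g)).compl₁₂ (TensorAlgebra.ι k) (TensorAlgebra.ι k)).flip -
    L.bracket.compr₂ (TensorAlgebra.ι k)

theorem relator_apply (i j : Bideg) (x y : g) : L.relator i j x y =
    TensorAlgebra.ι k x * TensorAlgebra.ι k y -
      ksign k i j • (TensorAlgebra.ι k y * TensorAlgebra.ι k x) -
      TensorAlgebra.ι k (L.bracket x y) := rfl

theorem map_mul_relator_mul_eq_zero_iff (P : TensorAlgebra k g →ₗ[k] S) (i j : Bideg) (x y : g)
    (u v : TensorAlgebra k g) : P (u * L.relator i j x y * v) = 0 ↔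
      P (u * (TensorAlgebra.ι k x * (TensorAlgebra.ι k y * v))) =
        ksign k i j • P (u * (TensorAlgebra.ι k y * (TensorAlgebra.ι k x * v))) +
          P (u * (TensorAlgebra.ι k (L.bracket x y) * v)) := by
  simp only [relator_apply, mul_sub, sub_mul, mul_smul_comm, smul_mul_assoc, map_sub, map_smul,
    mul_assoc]
  rw [sub_sub, sub_eq_zero]

/-- A linear map on the tensor algebra respects, in tensor degrees at most `n`, the defining
relations of the enveloping algebra. -/
def RespectsRel (n : ℕ) (P : TensorAlgebra k g →ₗ[k] S) : Prop :=
  ∀ p q, p + q + 2 ≤ n → ∀ u ∈ tensorDeg k g p, ∀ v ∈ tensorDeg k g q, ∀ (i j : Bideg) (x y : g),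
    x ∈ L.comp i → y ∈ L.comp j → P (u * L.relator i j x y * v) = 0

variable {L}

theorem RespectsRel.congr {n : ℕ} {P P' : TensorAlgebra k g →ₗ[k] S} (hP : L.RespectsRel n P)
    (h : ∀ m ≤ n, ∀ t ∈ tensorDeg k g m, P' t = P t) : L.RespectsRel n P' := by
  intro p q hpq u hu v hv i j x y hx hy
  have hxy : ∀ x y : g, u * (TensorAlgebra.ι k x * (TensorAlgebra.ι k y * v)) ∈
      tensorDeg k g (p + (q + 1 + 1)) := fun x y =>
    mul_mem_tensorDeg hu (ι_mul_mem_tensorDeg x (ι_mul_mem_tensorDeg y hv))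
  have hbracket := mul_mem_tensorDeg hu (ι_mul_mem_tensorDeg (L.bracket x y) hv)
  rw [map_mul_relator_mul_eq_zero_iff, h _ (by omega) _ (hxy x y), h _ (by omega) _ (hxy y x),
    h _ (by omega) _ hbracket, ← map_mul_relator_mul_eq_zero_iff]
  exact hP p q hpq u hu v hv i j x y hx hy

theorem map_mul_relator_mul_eq_zero {P : TensorAlgebra k g →ₗ[k] S}
    (hP : ∀ n, L.RespectsRel n P) (u v : TensorAlgebra k g) {i j : Bideg} {x y : g}
    (hx : x ∈ L.comp i) (hy : y ∈ L.comp j) : P (u * L.relator i j x y * v) = 0 := by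
  have htop : ∀ t : TensorAlgebra k g, t ∈ Submodule.span k (⋃ n, (tensorDeg k g n : Set _)) :=
    fun t => by rw [Submodule.span_iUnion]; simp [iSup_tensorDeg]
  refine LinearMap.BilinMap.apply_apply_mem_of_mem_span ⊥ _ _
    (((LinearMap.mul k _).compl₁₂ (LinearMap.mulRight k (L.relator i j x y)) .id).compr₂ P)
    (fun u hu v hv => ?_) u v (htop u) (htop v)
  obtain ⟨p, hu⟩ := Set.mem_iUnion.1 hu
  obtain ⟨q, hv⟩ := Set.mem_iUnion.1 hv
  exact hP _ p q le_rfl u hu v hv i j x y hx hy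

variable (L) in
/-- A homogeneous basis of `g`, with the bidegrees of its elements. -/
structure HomogBasis (I : Type*) where
  basis : Module.Basis I k g
  deg : I → Bideg
  le_span : ∀ d, L.comp d ≤ Submodule.span k (basis '' {i | deg i = d})
  mem : ∀ i, basis i ∈ L.comp (deg i)

variable (L) in
theorem exists_homogBasis :
    Nonempty (L.HomogBasis (Σ d : Bideg, Module.Basis.ofVectorSpaceIndex k (L.comp d))) := by
  let v := fun d : Bideg => Module.Basis.ofVectorSpace k (L.comp d)
  refine ⟨⟨L.isInternal.collectedBasis v, Sigma.fst, fun d => ?_,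
    fun i => L.isInternal.collectedBasis_mem v i⟩⟩
  rw [← Submodule.map_subtype_top (L.comp d), ← (v d).span_eq, Submodule.map_span]
  refine Submodule.span_mono ?_
  rintro _ ⟨_, ⟨j, rfl⟩, rfl⟩
  exact ⟨⟨d, j⟩, rfl, by rw [L.isInternal.collectedBasis_coe]; rfl⟩

variable {I : Type*} (B : L.HomogBasis I)

theorem HomogBasis.respectsRel_of_tensorWord {n : ℕ} {P : TensorAlgebra k g →ₗ[k] S}
    (h : ∀ (u v : List I) (a b : I), u.length + v.length + 2 ≤ n →
      P (tensorWord B.basis u * L.relator (B.deg a) (B.deg b) (B.basis a) (B.basis b) *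
        tensorWord B.basis v) = 0) : L.RespectsRel n P := by
  intro p q hpq u hu v hv i j x y hx hy
  rw [tensorDeg_eq_span B.basis] at hu hv
  refine LinearMap.BilinMap.apply_apply_mem_of_mem_span ⊥ _ _
    (((LinearMap.mul k _).compl₁₂ (LinearMap.mulRight k (L.relator i j x y)) .id).compr₂ P)
    ?_ u v hu hv
  rintro _ ⟨u, rfl, rfl⟩ _ ⟨v, rfl, rfl⟩
  refine LinearMap.BilinMap.apply_apply_mem_of_mem_span ⊥ _ _
    ((L.relator i j).compr₂ (P ∘ₗ LinearMap.mulRight k (tensorWord B.basis v) ∘ₗ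
      LinearMap.mulLeft k (tensorWord B.basis u))) ?_ x y (B.le_span i hx) (B.le_span j hy)
  rintro _ ⟨a, rfl, rfl⟩ _ ⟨b, rfl, rfl⟩
  exact h u v a b hpq

end GradedLieSuperalgebra

namespace GradedLieSuperalgebra

section AffineSwap

variable {k g I S : Type*} [Field k] [AddCommGroup g] [Module k g] {L : GradedLieSuperalgebra k g}
  [AddCommGroup S] [Module k S] (B : L.HomogBasis I)

/-- For a linear map `P` on the tensor algebra, the affine map sending a function `f` on words to
`w ↦ ε f(w') + P(w'')` on the words of length `n`, where `w'` is obtained from `w` by exchanging the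
entries in positions `i` and `i + 1`, `w''` by replacing them by their bracket, and `ε` is their
Koszul sign; on the other words, `f` is not changed. The common fixed points of these maps are the
functions which respect, in degree `n`, the relations of the enveloping algebra. -/
def HomogBasis.affineSwap (P : TensorAlgebra k g →ₗ[k] S) (n i : ℕ) :
    (List I → S) →ᵃ[k] (List I → S) :=
  AffineMap.pi fun w => if w.length = n then
      match w.drop i with
      | a :: b :: v =>
        ksign k (B.deg a) (B.deg b) • (LinearMap.proj (w.take i ++ b :: a :: v)).toAffineMap +
          AffineMap.const k _ (P (tensorWord B.basis (w.take i) *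
            (TensorAlgebra.ι k (L.bracket (B.basis a) (B.basis b)) * tensorWord B.basis v)))
      | _ => AffineMap.proj w
    else AffineMap.proj w

theorem HomogBasis.affineSwap_append (P : TensorAlgebra k g →ₗ[k] S) {n i : ℕ} (f : List I → S)
    {u v : List I} {a b : I} (hu : u.length = i) (h : (u ++ a :: b :: v).length = n) :
    B.affineSwap P n i f (u ++ a :: b :: v) =
      ksign k (B.deg a) (B.deg b) • f (u ++ b :: a :: v) +
        P (tensorWord B.basis u * (TensorAlgebra.ι k (L.bracket (B.basis a) (B.basis b)) *
          tensorWord B.basis v)) := by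
  subst hu h
  simp [affineSwap]

theorem HomogBasis.affineSwap_of_length_ne (P : TensorAlgebra k g →ₗ[k] S) {n : ℕ} (i : ℕ)
    (f : List I → S) {w : List I} (h : w.length ≠ n) : B.affineSwap P n i f w = f w := by
  simp [affineSwap, h]

theorem exists_eq_append_cons_cons {i : ℕ} {w : List I} (h : i + 1 < w.length) :
    ∃ (u : List I) (a b : I) (v : List I), w = u ++ a :: b :: v ∧ u.length = i :=
  ⟨w.take i, w[i], w[i + 1], w.drop (i + 1 + 1), by
    rw [← List.drop_eq_getElem_cons, ← List.drop_eq_getElem_cons, List.take_append_drop],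
    List.length_take_of_le (by omega)⟩

theorem HomogBasis.affineSwap_involutive (P : TensorAlgebra k g →ₗ[k] S) {n i : ℕ}
    (hi : i + 1 < n) : Function.Involutive (B.affineSwap P n i) := by
  intro f
  funext w
  by_cases hw : w.length = n
  swap
  · rw [affineSwap_of_length_ne B P i _ hw, affineSwap_of_length_ne B P i _ hw]
  obtain ⟨u, a, b, v, rfl, hu⟩ := exists_eq_append_cons_cons (hw ▸ hi)
  rw [affineSwap_append B P _ hu hw, affineSwap_append B P _ hu (by simpa using hw),
    L.bracket_skew (B.mem a) (B.mem b), ksign_comm k (B.deg b)]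
  simp only [map_neg, map_smul, neg_mul, mul_neg, smul_mul_assoc, mul_smul_comm, smul_add,
    smul_smul, ksign_mul_self, one_smul]
  abel

variable {P : TensorAlgebra k g →ₗ[k] S} {n : ℕ}

theorem HomogBasis.affineSwap_comm (hP : L.RespectsRel n P) {i j : ℕ} (hij : i + 1 < j)
    (hj : j < n) (f : List I → S) :
    B.affineSwap P (n + 1) i (B.affineSwap P (n + 1) j f) =
      B.affineSwap P (n + 1) j (B.affineSwap P (n + 1) i f) := by
  funext w
  by_cases hw : w.length = n + 1
  swap
  · simp only [affineSwap_of_length_ne B P _ _ hw]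
  obtain ⟨w, c, d, v', rfl, hwj⟩ := exists_eq_append_cons_cons (w := w) (i := j) (by omega)
  obtain ⟨u, a, b, v, rfl, hu⟩ := exists_eq_append_cons_cons (w := w) (i := i) (by omega)
  have swap_i : ∀ (f : List I → S) x y z t, B.affineSwap P (n + 1) i f
      (u ++ x :: y :: (v ++ z :: t :: v')) = _ := fun f x y z t =>
    B.affineSwap_append P f hu (by simpa using hw)
  have swap_j : ∀ (f : List I → S) x y z t, B.affineSwap P (n + 1) j f
      ((u ++ x :: y :: v) ++ z :: t :: v') = _ := fun f x y z t =>
    B.affineSwap_append P f (by simpa using hwj) (by simpa using hw)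
  simp only [List.append_assoc, List.cons_append] at swap_j ⊢
  rw [swap_i, swap_j, swap_j, swap_i]
  have hlen : u.length + v.length + v'.length + 4 = n + 1 := by
    simp only [List.length_append, List.length_cons] at hw
    omega
  have word_mem := tensorWord_mem_tensorDeg B.basis
  have rel_ab := hP u.length (v.length + (v'.length + 1)) (by omega) _ (word_mem u) _
    (mul_mem_tensorDeg (word_mem v)
      (ι_mul_mem_tensorDeg (L.bracket (B.basis c) (B.basis d)) (word_mem v')))
    _ _ _ _ (B.mem a) (B.mem b)
  have rel_cd := hP (u.length + (v.length + 1)) v'.length (by omega) _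
    (mul_mem_tensorDeg (word_mem u)
      (ι_mul_mem_tensorDeg (L.bracket (B.basis a) (B.basis b)) (word_mem v)))
    _ (word_mem v') _ _ _ _ (B.mem c) (B.mem d)
  rw [map_mul_relator_mul_eq_zero_iff] at rel_ab rel_cd
  simp only [tensorWord_append, tensorWord_cons, mul_assoc] at rel_ab rel_cd ⊢
  rw [rel_ab, rel_cd]
  module

theorem HomogBasis.affineSwap_braid (hP : L.RespectsRel n P) {i : ℕ} (hi : i + 1 < n)
    (f : List I → S) :
    B.affineSwap P (n + 1) i (B.affineSwap P (n + 1) (i + 1) (B.affineSwap P (n + 1) i f)) =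
      B.affineSwap P (n + 1) (i + 1)
        (B.affineSwap P (n + 1) i (B.affineSwap P (n + 1) (i + 1) f)) := by
  funext w
  by_cases hw : w.length = n + 1
  swap
  · simp only [affineSwap_of_length_ne B P _ _ hw]
  obtain ⟨u, a, b, v, rfl, hu⟩ := exists_eq_append_cons_cons (w := w) (i := i) (by omega)
  have hlen : u.length + v.length + 2 = n + 1 := by
    simpa only [List.length_append, List.length_cons, ← add_assoc] using hw
  obtain ⟨c, v, rfl⟩ := List.exists_cons_of_length_pos (l := v) (by omega)
  rw [List.length_cons] at hlen
  have swap_i : ∀ (f : List I → S) x y z, B.affineSwap P (n + 1) i f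
      (u ++ x :: y :: (z :: v)) = _ := fun f x y z =>
    B.affineSwap_append P f hu (by simpa using hw)
  have swap_succ : ∀ (f : List I → S) x y z, B.affineSwap P (n + 1) (i + 1) f
      ((u ++ [x]) ++ y :: z :: v) = _ := fun f x y z =>
    B.affineSwap_append P f (by simpa using hu) (by simpa using hw)
  simp only [List.append_assoc, List.singleton_append] at swap_succ
  rw [swap_i, swap_succ, swap_i, swap_succ, swap_i, swap_succ]
  have rel := fun (i j : Bideg) (x y : g) (hx : x ∈ L.comp i) (hy : y ∈ L.comp j) =>
    (L.map_mul_relator_mul_eq_zero_iff P i j x y _ _).1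
      (hP u.length v.length (by omega) _ (tensorWord_mem_tensorDeg B.basis u) _
        (tensorWord_mem_tensorDeg B.basis v) i j x y hx hy)
  have rel_ab_c := rel _ _ _ _ (L.bracket_mem (B.mem a) (B.mem b)) (B.mem c)
  have rel_b_ac := rel _ _ _ _ (B.mem b) (L.bracket_mem (B.mem a) (B.mem c))
  have rel_a_bc := rel _ _ _ _ (B.mem a) (L.bracket_mem (B.mem b) (B.mem c))
  have jacobi := congrArg (fun x => P (tensorWord B.basis u * (TensorAlgebra.ι k x *
    tensorWord B.basis v))) (L.bracket_jacobi (B.mem a) (B.mem b) (B.mem c))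
  simp only [map_add, map_smul, add_mul, mul_add, smul_mul_assoc, mul_smul_comm] at jacobi
  simp only [ksign_add_left, ksign_add_right] at rel_ab_c rel_b_ac rel_a_bc
  rw [ksign_comm k (B.deg b) (B.deg a)] at rel_b_ac
  simp only [tensorWord_append, tensorWord_cons, tensorWord_nil, mul_assoc, one_mul]
  rw [rel_ab_c, rel_a_bc, jacobi, rel_b_ac]
  simp only [smul_add, smul_smul, ← mul_assoc, ksign_mul_self]
  simp only [mul_comm, mul_left_comm, mul_assoc]
  module

theorem HomogBasis.satisfiesCoxeterRelations_affineSwap (hP : L.RespectsRel n P) :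
    SatisfiesCoxeterRelations (fun i => B.affineSwap P (n + 1) i) n where
  involutive _ hi := B.affineSwap_involutive P (by omega)
  comm _ _ hij hj := B.affineSwap_comm hP hij hj
  braid _ hi := B.affineSwap_braid hP hi

end AffineSwap

end GradedLieSuperalgebra

namespace GradedLieSuperalgebra

variable {k g I S : Type*} [Field k] [AddCommGroup g] [Module k g] {L : GradedLieSuperalgebra k g}
  [AddCommGroup S] [Module k S] (B : L.HomogBasis I) {P π : TensorAlgebra k g →ₗ[k] S} {n : ℕ}

theorem HomogBasis.affineSwap_sub_mem {F : Submodule k S} (hP : ∀ t ∈ tensorDeg k g n, P t ∈ F)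
    (hπ : L.toGradedSuperspace.abelian.RespectsRel (n + 1) π) {f : List I → S}
    (hf : ∀ w, w.length = n + 1 → f w - π (tensorWord B.basis w) ∈ F) {i : ℕ} (hi : i < n)
    {w : List I} (hw : w.length = n + 1) :
    B.affineSwap P (n + 1) i f w - π (tensorWord B.basis w) ∈ F := by
  obtain ⟨u, a, b, v, rfl, hu⟩ := exists_eq_append_cons_cons (w := w) (i := i) (by omega)
  have hlen : u.length + v.length + 2 = n + 1 := by
    simpa only [List.length_append, List.length_cons, ← add_assoc] using hw
  have hswap : π (tensorWord B.basis (u ++ a :: b :: v)) =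
      ksign k (B.deg a) (B.deg b) • π (tensorWord B.basis (u ++ b :: a :: v)) := by
    have := hπ _ _ hlen.le _ (tensorWord_mem_tensorDeg B.basis u) _
      (tensorWord_mem_tensorDeg B.basis v) _ _ _ _ (B.mem a) (B.mem b)
    simpa [map_mul_relator_mul_eq_zero_iff, GradedSuperspace.abelian] using this
  have hbracket := hP _ <| Nat.succ_injective hlen ▸
    mul_mem_tensorDeg (tensorWord_mem_tensorDeg B.basis u)
      (ι_mul_mem_tensorDeg (L.bracket (B.basis a) (B.basis b)) (tensorWord_mem_tensorDeg B.basis v))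
  rw [affineSwap_append B P f hu hw, hswap, add_sub_right_comm, ← smul_sub]
  exact add_mem (F.smul_mem _ (hf _ (by simpa using hw))) hbracket

theorem HomogBasis.exists_affineSwap_eq_self [CharZero k] {F : Submodule k S}
    (hP : L.RespectsRel n P) (hPF : ∀ t ∈ tensorDeg k g n, P t ∈ F)
    (hπ : L.toGradedSuperspace.abelian.RespectsRel (n + 1) π) :
    ∃ f : List I → S, (∀ w, w.length = n + 1 → f w - π (tensorWord B.basis w) ∈ F) ∧
      (∀ w, w.length ≠ n + 1 → f w = P (tensorWord B.basis w)) ∧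
      ∀ i < n, B.affineSwap P (n + 1) i f = f := by
  let N : AffineSubspace k (List I → S) := AffineSubspace.mk'
    (fun w => if w.length = n + 1 then π (tensorWord B.basis w) else P (tensorWord B.basis w))
    (Submodule.pi Set.univ fun w => if w.length = n + 1 then F else ⊥)
  have mem_N : ∀ f, f ∈ N ↔ (∀ w, w.length = n + 1 → f w - π (tensorWord B.basis w) ∈ F) ∧
      ∀ w, w.length ≠ n + 1 → f w = P (tensorWord B.basis w) := fun f => by
    rw [AffineSubspace.mem_mk', Submodule.mem_pi, ← forall_and]
    refine forall_congr' fun w => ?_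
    by_cases hw : w.length = n + 1 <;> simp [hw, sub_eq_zero]
  obtain ⟨f, hfN, hf⟩ := (B.satisfiesCoxeterRelations_affineSwap hP).exists_mem_fixed (N := N)
    (fun i hi f hf => by
      rw [mem_N] at hf ⊢
      exact ⟨fun w hw => B.affineSwap_sub_mem hPF hπ hf.1 hi hw,
        fun w hw => (B.affineSwap_of_length_ne P i f hw).trans (hf.2 w hw)⟩)
    ⟨_, AffineSubspace.self_mem_mk' _ _⟩
  rw [mem_N] at hfN
  exact ⟨f, hfN.1, hfN.2, hf⟩

variable {F : ℕ → Submodule k S}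

theorem HomogBasis.exists_respectsRel_succ [CharZero k] (B : L.HomogBasis I)
    (hF : Monotone F)
    (hπ : ∀ n, L.toGradedSuperspace.abelian.RespectsRel n π)
    (hπF : ∀ n, ∀ t ∈ tensorDeg k g n, π t ∈ F (n + 1)) (hP : L.RespectsRel n P)
    (hPF : ∀ n, ∀ t ∈ tensorDeg k g n, P t - π t ∈ F n) :
    ∃ P' : TensorAlgebra k g →ₗ[k] S, L.RespectsRel (n + 1) P' ∧
      (∀ n, ∀ t ∈ tensorDeg k g n, P' t - π t ∈ F n) ∧
        ∀ m ≤ n, ∀ t ∈ tensorDeg k g m, P' t = P t := by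
  have hPn : ∀ t ∈ tensorDeg k g n, P t ∈ F (n + 1) := fun t ht =>
    sub_add_cancel (P t) (π t) ▸ add_mem (hF n.le_succ (hPF n t ht)) (hπF n t ht)
  obtain ⟨f, hf, hf', hfix⟩ := B.exists_affineSwap_eq_self hP hPn (hπ (n + 1))
  obtain ⟨P', hP'⟩ := exists_linearMap_tensorWord B.basis f
  have agree : ∀ m ≤ n, ∀ t ∈ tensorDeg k g m, P' t = P t := by
    intro m hm t ht
    rw [tensorDeg_eq_span B.basis] at ht
    refine LinearMap.eqOn_span ?_ ht
    rintro _ ⟨w, rfl, rfl⟩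
    exact (hP' w).trans (hf' w (by omega))
  refine ⟨P', B.respectsRel_of_tensorWord fun u v a b huv => ?_, fun m t ht => ?_, agree⟩
  · have hu := tensorWord_mem_tensorDeg B.basis u
    have hv := tensorWord_mem_tensorDeg B.basis v
    rcases huv.lt_or_eq with hlt | heq
    · exact hP.congr agree _ _ (by omega) _ hu _ hv _ _ _ _ (B.mem a) (B.mem b)
    rw [map_mul_relator_mul_eq_zero_iff, agree (u.length + (v.length + 1)) (by omega) _
      (mul_mem_tensorDeg hu (ι_mul_mem_tensorDeg _ hv))]
    have := B.affineSwap_append P f (u := u) (v := v) (a := a) (b := b) rfl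
      (by simpa only [List.length_append, List.length_cons, ← add_assoc] using heq)
    rw [hfix _ (by omega), ← hP', ← hP'] at this
    simpa only [tensorWord_append, tensorWord_cons] using this
  · rw [tensorDeg_eq_span B.basis] at ht
    suffices h : Submodule.span k (tensorWord B.basis '' {w | w.length = m}) ≤
        (F m).comap (P' - π) from h ht
    rw [Submodule.span_le]
    rintro _ ⟨w, rfl, rfl⟩
    rw [SetLike.mem_coe, Submodule.mem_comap, LinearMap.sub_apply, hP']
    by_cases hw : w.length = n + 1
    · exact hw ▸ hf w hw
    · exact hf' w hw ▸ hPF _ _ (tensorWord_mem_tensorDeg B.basis w)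

theorem HomogBasis.exists_linearMap_eq_of_compatible (B : L.HomogBasis I)
    (Q : ℕ → TensorAlgebra k g →ₗ[k] S)
    (hQ : ∀ n, ∀ m ≤ n, ∀ t ∈ tensorDeg k g m, Q (n + 1) t = Q n t) :
    ∃ P : TensorAlgebra k g →ₗ[k] S, ∀ n, ∀ m ≤ n, ∀ t ∈ tensorDeg k g m, P t = Q n t := by
  obtain ⟨P, hP⟩ := exists_linearMap_tensorWord B.basis fun w => Q w.length (tensorWord B.basis w)
  refine ⟨P, fun n m hmn t ht => ?_⟩
  induction n, hmn using Nat.le_induction with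
  | base =>
    rw [tensorDeg_eq_span B.basis] at ht
    refine LinearMap.eqOn_span ?_ ht
    rintro _ ⟨w, rfl, rfl⟩
    exact hP w
  | succ n hmn ih => rw [ih, hQ n m hmn t ht]

theorem HomogBasis.exists_respectsRel [CharZero k] (B : L.HomogBasis I)
    (hF : Monotone F)
    (hπ : ∀ n, L.toGradedSuperspace.abelian.RespectsRel n π)
    (hπF : ∀ n, ∀ t ∈ tensorDeg k g n, π t ∈ F (n + 1)) :
    ∃ P : TensorAlgebra k g →ₗ[k] S, (∀ n, L.RespectsRel n P) ∧
      ∀ n, ∀ t ∈ tensorDeg k g n, P t - π t ∈ F n := by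
  let Good : ℕ → Type _ := fun n => {P : TensorAlgebra k g →ₗ[k] S //
    L.RespectsRel n P ∧ ∀ n, ∀ t ∈ tensorDeg k g n, P t - π t ∈ F n}
  have exists_next : ∀ n (P : Good n), ∃ P' : Good (n + 1),
      ∀ m ≤ n, ∀ t ∈ tensorDeg k g m, P'.1 t = P.1 t := fun n P => by
    obtain ⟨P', hP', hP'F, agree⟩ := B.exists_respectsRel_succ hF hπ hπF P.2.1 P.2.2
    exact ⟨⟨P', hP', hP'F⟩, agree⟩
  choose next hnext using exists_next
  let Q : ∀ n, Good n :=
    fun n => Nat.rec ⟨π, fun p q h => absurd h (Nat.not_succ_le_zero _), by simp⟩ next n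
  obtain ⟨P, hP⟩ := B.exists_linearMap_eq_of_compatible (fun n => (Q n).1)
    fun n => hnext n (Q n)
  exact ⟨P, fun n => (Q n).2.1.congr (hP n),
    fun n t ht => hP n n le_rfl t ht ▸ (Q n).2.2 n t ht⟩

variable (L) in
/-- The canonical map from the tensor algebra to the enveloping algebra. -/
def mkU : TensorAlgebra k g →ₐ[k] L.U := RingQuot.mkAlgHom k L.Rel

theorem mkU_ι (x : g) : L.mkU (TensorAlgebra.ι k x) = L.ι x := rfl

theorem mkU_surjective : Function.Surjective L.mkU := RingQuot.mkAlgHom_surjective k L.Rel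

theorem mkU_relator {i j : Bideg} {x y : g} (hx : x ∈ L.comp i) (hy : y ∈ L.comp j) :
    L.mkU (L.relator i j x y) = 0 := by
  simp only [relator_apply, map_sub, map_smul, map_mul, mkU_ι, ι_mul_ι_eq hx hy]
  abel

theorem respectsRel_mkU (n : ℕ) : L.RespectsRel n L.mkU.toLinearMap :=
  fun p q _ u _ v _ i j x y hx hy => by simp [mkU_relator hx hy]

theorem mkU_list_prod (l : List (Bideg × g)) :
    L.mkU (l.map fun a => TensorAlgebra.ι k a.2).prod = L.prodι l := by
  rw [map_list_prod, List.map_map]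
  rfl

theorem list_prod_mem_tensorDeg (l : List (Bideg × g)) :
    (l.map fun a => TensorAlgebra.ι k a.2).prod ∈ tensorDeg k g l.length := by
  induction l with
  | nil => exact SetLike.one_mem_graded (tensorDeg k g)
  | cons a l ih =>
    rw [List.map_cons, List.prod_cons, List.length_cons]
    exact ι_mul_mem_tensorDeg _ ih

theorem map_eq_of_ringQuot_rel {P : TensorAlgebra k g →ₗ[k] S} (hP : ∀ n, L.RespectsRel n P)
    {a b : TensorAlgebra k g} (hab : RingQuot.Rel L.Rel a b) (u v : TensorAlgebra k g) :
    P (u * a * v) = P (u * b * v) := by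
  induction hab generalizing u v with
  | of h =>
    obtain ⟨hx, hy⟩ := h
    rw [← sub_eq_zero, ← map_sub, ← sub_mul, ← mul_sub, ← sub_sub, ← ksign_smul (k := k)]
    exact map_mul_relator_mul_eq_zero hP u v hx hy
  | add_left _ ih => simp only [mul_add, add_mul, map_add, ih]
  | mul_left _ ih => simpa only [mul_assoc] using ih u (_ * v)
  | mul_right _ ih => simpa only [mul_assoc] using ih (u * _) v

theorem map_eq_of_mkU_eq {P : TensorAlgebra k g →ₗ[k] S} (hP : ∀ n, L.RespectsRel n P)
    {a b : TensorAlgebra k g} (hab : L.mkU a = L.mkU b) : P a = P b := by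
  have : RingQuot.mkRingHom L.Rel a = RingQuot.mkRingHom L.Rel b := by
    rw [← RingQuot.mkAlgHom_coe k L.Rel]
    exact hab
  simp only [RingQuot.mkRingHom_def] at this
  have hquot : Quot.mk (RingQuot.Rel L.Rel) a = Quot.mk _ b := congrArg RingQuot.toQuot this
  exact congrArg (Quot.lift P fun a b h => by simpa using map_eq_of_ringQuot_rel hP h 1 1) hquot

theorem exists_linearMap_mkU {P : TensorAlgebra k g →ₗ[k] S} (hP : ∀ n, L.RespectsRel n P) :
    ∃ P' : L.U →ₗ[k] S, ∀ t, P' (L.mkU t) = P t := by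
  obtain ⟨s, hs⟩ := L.mkU.toLinearMap.exists_rightInverse_of_surjective
    (LinearMap.range_eq_top.2 L.mkU_surjective)
  exact ⟨P ∘ₗ s, fun t => map_eq_of_mkU_eq hP (LinearMap.congr_fun hs (L.mkU t))⟩

theorem mkU_mem_filLT {n : ℕ} {t : TensorAlgebra k g} (ht : t ∈ tensorDeg k g n) :
    L.mkU t ∈ L.filLT (n + 1) := by
  induction n generalizing t with
  | zero =>
    rw [tensorDeg, pow_zero, Submodule.one_eq_span] at ht
    obtain ⟨c, rfl⟩ := Submodule.mem_span_singleton.1 ht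
    rw [map_smul, map_one]
    exact Submodule.smul_mem _ _ (L.prodι_mem_filLT isHomog_nil one_pos)
  | succ n ih =>
    rw [tensorDeg, pow_succ'] at ht
    induction ht using Submodule.mul_induction_on' with
    | mem_mul_mem a ha b hb =>
      obtain ⟨x, rfl⟩ := ha
      rw [map_mul, mkU_ι]
      exact L.ι_mul_mem_filLT x (ih hb)
    | add a _ b _ ha hb => rw [map_add]; exact add_mem ha hb

variable (L) in
/-- The injectivity part of the Poincaré–Birkhoff–Witt theorem: on leading terms, `P` inverts the
map `Sym(g) → gr U(g)`. -/
theorem exists_linearMap_prodι_sub_prodι_mem_filLT [CharZero k] :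
    ∃ P : L.U →ₗ[k] L.toGradedSuperspace.Sym, ∀ l,
      P (L.prodι l) - L.toGradedSuperspace.abelian.prodι l ∈
        L.toGradedSuperspace.abelian.filLT l.length := by
  obtain ⟨B⟩ := L.exists_homogBasis
  let A := L.toGradedSuperspace.abelian
  obtain ⟨P, hP, hPF⟩ := B.exists_respectsRel (A.filLT_mono) A.respectsRel_mkU
    fun n t ht => A.mkU_mem_filLT ht
  obtain ⟨P', hP'⟩ := exists_linearMap_mkU hP
  refine ⟨P', fun l => ?_⟩
  rw [← mkU_list_prod, ← mkU_list_prod, hP']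
  exact hPF _ _ (list_prod_mem_tensorDeg l)

end GradedLieSuperalgebra

/-! ### The coalgebra structure -/

section Twist

variable {k A B : Type*} [Field k] [Ring A] [Algebra k A] [Ring B] [Algebra k B]
  (𝒜 : Bideg → Submodule k A) [GradedAlgebra 𝒜] (ℬ : Bideg → Submodule k B) [GradedAlgebra ℬ]

theorem linearMap_ext_homogeneous {M : Type*} [AddCommGroup M] [Module k M] {f f' : A →ₗ[k] M}
    (h : ∀ (e : Bideg) (a : A), a ∈ 𝒜 e → f a = f' a) : f = f' := by
  ext a
  induction a using DirectSum.Decomposition.inductionOn 𝒜 with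
  | zero => rw [map_zero, map_zero]
  | homogeneous a => exact h _ _ a.2
  | add a b ha hb => rw [map_add, map_add, ha, hb]

theorem linearMap_ext_homogeneous_tmul {M : Type*} [AddCommGroup M] [Module k M]
    {f f' : A ⊗[k] B →ₗ[k] M}
    (h : ∀ (e : Bideg) (a : A), a ∈ 𝒜 e → ∀ b, f (a ⊗ₜ b) = f' (a ⊗ₜ b)) : f = f' :=
  TensorProduct.ext <| linearMap_ext_homogeneous 𝒜 fun e a ha => LinearMap.ext (h e a ha)

/-- The operator which multiplies a homogeneous element `a` by the Koszul sign of `a` with an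
element of bidegree `d`. -/
def twist (d : Bideg) : A →ₗ[k] A :=
  (DirectSum.toModule k Bideg A fun e => ksign k d e • (𝒜 e).subtype) ∘ₗ
    (DirectSum.decomposeLinearEquiv 𝒜).toLinearMap

variable {𝒜} in
theorem twist_of_mem (d : Bideg) {e : Bideg} {a : A} (ha : a ∈ 𝒜 e) :
    twist 𝒜 d a = ksign k d e • a := by
  simp only [twist, LinearMap.comp_apply, LinearEquiv.coe_coe,
    DirectSum.decomposeLinearEquiv_apply, DirectSum.decompose_of_mem 𝒜 ha]
  rw [← DirectSum.lof_eq_of k, DirectSum.toModule_lof]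
  rfl

theorem twist_one (d : Bideg) : twist 𝒜 d 1 = 1 := by
  rw [twist_of_mem d (SetLike.GradedOne.one_mem (A := 𝒜)), ksign_zero_right, one_smul]

theorem twist_twist (d d' : Bideg) (a : A) :
    twist 𝒜 d (twist 𝒜 d' a) = twist 𝒜 d' (twist 𝒜 d a) := by
  refine LinearMap.congr_fun (f := twist 𝒜 d ∘ₗ twist 𝒜 d') (g := twist 𝒜 d' ∘ₗ twist 𝒜 d)
    (linearMap_ext_homogeneous 𝒜 fun e a ha => ?_) a
  simp only [LinearMap.comp_apply, twist_of_mem _ ha, map_smul]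
  rw [smul_comm]

theorem twist_mul_of_mem (d : Bideg) {i : Bideg} {x : A} (hx : x ∈ 𝒜 i) (a : A) :
    twist 𝒜 d (x * a) = ksign k d i • (x * twist 𝒜 d a) := by
  refine LinearMap.congr_fun (f := twist 𝒜 d ∘ₗ LinearMap.mulLeft k x)
    (g := ksign k d i • (LinearMap.mulLeft k x ∘ₗ twist 𝒜 d))
    (linearMap_ext_homogeneous 𝒜 fun e a ha => ?_) a
  simp only [LinearMap.comp_apply, LinearMap.smul_apply, LinearMap.mulLeft_apply,
    twist_of_mem _ ha, twist_of_mem _ (SetLike.mul_mem_graded hx ha), ksign_add_right,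
    mul_smul_comm, smul_smul]

variable {ℬ} in
theorem map_twist {f : A →ₗ[k] B} (hf : ∀ (d : Bideg) (a : A), a ∈ 𝒜 d → f a ∈ ℬ d) (d : Bideg)
    (a : A) : f (twist 𝒜 d a) = twist ℬ d (f a) := by
  refine LinearMap.congr_fun (f := f ∘ₗ twist 𝒜 d) (g := twist ℬ d ∘ₗ f)
    (linearMap_ext_homogeneous 𝒜 fun e a ha => ?_) a
  simp only [LinearMap.comp_apply, twist_of_mem _ ha, twist_of_mem _ (hf _ _ ha), map_smul]

open GradedTensorProduct

theorem gradedTensor_mul_of_mem {j i : Bideg} (a : A) {b : B} (hb : b ∈ ℬ j) {a' : A}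
    (ha' : a' ∈ 𝒜 i) (b' : B) :
    (a ᵍ⊗ₜ[k] b * a' ᵍ⊗ₜ[k] b' : 𝒜 ᵍ⊗[k] ℬ) = ksign k j i • (a * a') ᵍ⊗ₜ[k] (b * b') := by
  rw [ksign_smul, ← uzpow_bideg]
  exact tmul_coe_mul_coe_tmul (R := k) 𝒜 ℬ a ⟨b, hb⟩ ⟨a', ha'⟩ b'

theorem gradedTensor_left_mul (x : A) (z : A ⊗[k] B) :
    (x ᵍ⊗ₜ[k] 1 * of k 𝒜 ℬ z : 𝒜 ᵍ⊗[k] ℬ) =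
      of k 𝒜 ℬ (TensorProduct.map (LinearMap.mulLeft k x) LinearMap.id z) := by
  refine LinearMap.congr_fun
    (f := LinearMap.mulLeft k (x ᵍ⊗ₜ[k] 1 : 𝒜 ᵍ⊗[k] ℬ) ∘ₗ (of k 𝒜 ℬ).toLinearMap)
    (g := (of k 𝒜 ℬ).toLinearMap ∘ₗ TensorProduct.map (LinearMap.mulLeft k x) LinearMap.id)
    (linearMap_ext_homogeneous_tmul 𝒜 fun e a ha b => ?_) z
  have := gradedTensor_mul_of_mem 𝒜 ℬ x (SetLike.GradedOne.one_mem (A := ℬ)) ha b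
  rwa [ksign_zero_left, one_smul, one_mul] at this

theorem gradedTensor_right_mul {d : Bideg} {x : B} (hx : x ∈ ℬ d) (z : A ⊗[k] B) :
    (1 ᵍ⊗ₜ[k] x * of k 𝒜 ℬ z : 𝒜 ᵍ⊗[k] ℬ) =
      of k 𝒜 ℬ (TensorProduct.map (twist 𝒜 d) (LinearMap.mulLeft k x) z) := by
  refine LinearMap.congr_fun
    (f := LinearMap.mulLeft k (1 ᵍ⊗ₜ[k] x : 𝒜 ᵍ⊗[k] ℬ) ∘ₗ (of k 𝒜 ℬ).toLinearMap)
    (g := (of k 𝒜 ℬ).toLinearMap ∘ₗ TensorProduct.map (twist 𝒜 d) (LinearMap.mulLeft k x))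
    (linearMap_ext_homogeneous_tmul 𝒜 fun e a ha b => ?_) z
  have := gradedTensor_mul_of_mem 𝒜 ℬ 1 hx ha b
  rw [one_mul] at this
  simp only [LinearMap.comp_apply, LinearEquiv.coe_coe, TensorProduct.map_tmul, twist_of_mem d ha]
  exact this

end Twist

namespace GradedLieSuperalgebra

variable {k g : Type*} [Field k] [AddCommGroup g] [Module k g] (L : GradedLieSuperalgebra k g)

open CoalgebraStruct

/-- The operator on `U(g) ⊗ U(g)` of left multiplication by `x ⊗ 1 + 1 ⊗ x` in the superalgebra
sense, for `x ∈ g` homogeneous of bidegree `d`. -/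
def primMul (d : Bideg) (x : g) : L.U ⊗[k] L.U →ₗ[k] L.U ⊗[k] L.U :=
  TensorProduct.map (LinearMap.mulLeft k (L.ι x)) LinearMap.id +
    TensorProduct.map (twist L.grading d) (LinearMap.mulLeft k (L.ι x))

theorem primMul_tmul (d : Bideg) (x : g) (a b : L.U) : L.primMul d x (a ⊗ₜ b) =
    (L.ι x * a) ⊗ₜ b + twist L.grading d a ⊗ₜ (L.ι x * b) := rfl

theorem comul_def (a : L.U) : comul (R := k) a =
    (GradedTensorProduct.of k L.grading L.grading).symm (L.comulAlgHom a) := rfl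

theorem comul_one : comul (R := k) (1 : L.U) = 1 ⊗ₜ 1 := by
  rw [comul_def, map_one]
  rfl

variable {L} in
theorem comul_ι_mul {d : Bideg} {x : g} (hx : x ∈ L.comp d) (a : L.U) :
    comul (R := k) (L.ι x * a) = L.primMul d x (comul a) := by
  have hleft := gradedTensor_left_mul L.grading L.grading (L.ι x) (comul (R := k) a)
  have hright := gradedTensor_right_mul L.grading L.grading (L.ι_mem hx) (comul (R := k) a)
  rw [comul_def, GradedTensorProduct.symm_of_of] at hleft hright
  rw [comul_def, map_mul, comulAlgHom_ι, primitive, LinearMap.add_apply, add_mul]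
  simp only [LinearMap.comp_apply, AlgHom.toLinearMap_apply,
    GradedTensorProduct.includeLeft_apply, GradedTensorProduct.includeRight_apply]
  rw [hleft, hright]
  rfl

theorem counit_one : counit (R := k) (1 : L.U) = 1 := map_one L.counitAlgHom

theorem counit_ι_mul (x : g) (a : L.U) : counit (R := k) (L.ι x * a) = 0 := by
  change L.counitAlgHom (L.ι x * a) = 0
  rw [map_mul, show L.counitAlgHom (L.ι x) = 0 from
    L.lift_ι (0 : g →ₗ[k] k) (by intros; simp) x, zero_mul]

theorem counit_prodι_of_ne_nil {l : List (Bideg × g)} (hl : l ≠ []) :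
    counit (R := k) (L.prodι l) = 0 := by
  obtain ⟨a, l, rfl⟩ := List.exists_cons_of_ne_nil hl
  rw [prodι_cons, counit_ι_mul]

variable {L}

theorem twist_ι_mul (d : Bideg) {i : Bideg} {x : g} (hx : x ∈ L.comp i) (a : L.U) :
    twist L.grading d (L.ι x * a) = ksign k d i • (L.ι x * twist L.grading d a) :=
  twist_mul_of_mem L.grading d (L.ι_mem hx) a

theorem counit_twist (d : Bideg) (a : L.U) :
    counit (R := k) (twist L.grading d a) = counit (R := k) a := by
  refine LinearMap.congr_fun (f := counit ∘ₗ twist L.grading d) (g := counit)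
    (L.linearMap_ext_ι_mul ?_ fun i x a hx _ => ?_) a
  · rw [LinearMap.comp_apply, twist_one]
  · rw [LinearMap.comp_apply, twist_ι_mul d hx, map_smul, counit_ι_mul, counit_ι_mul, smul_zero]

theorem primMul_map_twist (d : Bideg) {i : Bideg} {x : g} (hx : x ∈ L.comp i) :
    TensorProduct.map (twist L.grading d) (twist L.grading d) ∘ₗ L.primMul i x =
      ksign k d i •
        L.primMul i x ∘ₗ TensorProduct.map (twist L.grading d) (twist L.grading d) :=
  TensorProduct.ext' fun a b => by
    simp only [LinearMap.comp_apply, LinearMap.smul_apply, TensorProduct.map_tmul, primMul_tmul,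
      map_add, twist_ι_mul d hx, TensorProduct.smul_tmul', TensorProduct.tmul_smul, smul_add,
      twist_twist L.grading d i]

theorem comul_twist (d : Bideg) (a : L.U) : comul (R := k) (twist L.grading d a) =
    TensorProduct.map (twist L.grading d) (twist L.grading d) (comul a) := by
  refine LinearMap.congr_fun (f := comul ∘ₗ twist L.grading d)
    (g := TensorProduct.map (twist L.grading d) (twist L.grading d) ∘ₗ comul)
    (L.linearMap_ext_ι_mul ?_ fun i x a hx h => ?_) a
  · simp only [LinearMap.comp_apply, twist_one, comul_one, TensorProduct.map_tmul]
  · simp only [LinearMap.comp_apply] at h ⊢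
    rw [twist_ι_mul d hx, map_smul, comul_ι_mul hx, comul_ι_mul hx, h]
    exact (LinearMap.congr_fun (primMul_map_twist d hx) _).symm

theorem rTensor_comul_comp_primMul {d : Bideg} {x : g} (hx : x ∈ L.comp d) :
    comul.rTensor L.U ∘ₗ L.primMul d x =
      ((L.primMul d x).rTensor L.U + TensorProduct.map
        (TensorProduct.map (twist L.grading d) (twist L.grading d))
        (LinearMap.mulLeft k (L.ι x))) ∘ₗ comul.rTensor L.U :=
  TensorProduct.ext' fun a b => by simp [primMul_tmul, comul_twist, comul_ι_mul hx]

theorem lTensor_comul_comp_primMul {d : Bideg} {x : g} (hx : x ∈ L.comp d) :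
    comul.lTensor L.U ∘ₗ L.primMul d x =
      (TensorProduct.map (LinearMap.mulLeft k (L.ι x)) LinearMap.id +
        TensorProduct.map (twist L.grading d) (L.primMul d x)) ∘ₗ comul.lTensor L.U :=
  TensorProduct.ext' fun a b => by simp [primMul_tmul, comul_ι_mul hx]

theorem assoc_comp_primMul (d : Bideg) (x : g) :
    (TensorProduct.assoc k L.U L.U L.U).toLinearMap ∘ₗ ((L.primMul d x).rTensor L.U +
      TensorProduct.map (TensorProduct.map (twist L.grading d) (twist L.grading d))
        (LinearMap.mulLeft k (L.ι x))) =
      (TensorProduct.map (LinearMap.mulLeft k (L.ι x)) LinearMap.id +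
        TensorProduct.map (twist L.grading d) (L.primMul d x)) ∘ₗ
          (TensorProduct.assoc k L.U L.U L.U).toLinearMap :=
  TensorProduct.ext_threefold fun a b c => by
    simp [primMul_tmul, TensorProduct.add_tmul, TensorProduct.tmul_add, add_assoc]

theorem rTensor_counit_comp_primMul (d : Bideg) (x : g) :
    counit.rTensor L.U ∘ₗ L.primMul d x =
      (LinearMap.mulLeft k (L.ι x)).lTensor k ∘ₗ counit.rTensor L.U :=
  TensorProduct.ext' fun a b => by simp [primMul_tmul, counit_ι_mul, counit_twist]

theorem lTensor_counit_comp_primMul (d : Bideg) (x : g) :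
    counit.lTensor L.U ∘ₗ L.primMul d x =
      (LinearMap.mulLeft k (L.ι x)).rTensor k ∘ₗ counit.lTensor L.U :=
  TensorProduct.ext' fun a b => by simp [primMul_tmul, counit_ι_mul]

instance : Coalgebra k L.U where
  coassoc := by
    refine L.linearMap_ext_ι_mul (by simp [comul_one]) fun d x a hx h => ?_
    simp only [LinearMap.comp_apply, comul_ι_mul hx] at h ⊢
    rw [← LinearMap.comp_apply (comul.rTensor L.U), rTensor_comul_comp_primMul hx,
      ← LinearMap.comp_apply (comul.lTensor L.U), lTensor_comul_comp_primMul hx,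
      LinearMap.comp_apply, LinearMap.comp_apply, ← h]
    exact LinearMap.congr_fun (assoc_comp_primMul d x) _
  rTensor_counit_comp_comul := by
    refine L.linearMap_ext_ι_mul (by simp [comul_one, counit_one]) fun d x a hx h => ?_
    rw [LinearMap.comp_apply] at h ⊢
    rw [comul_ι_mul hx, ← LinearMap.comp_apply, rTensor_counit_comp_primMul,
      LinearMap.comp_apply, h]
    rfl
  lTensor_counit_comp_comul := by
    refine L.linearMap_ext_ι_mul (by simp [comul_one, counit_one]) fun d x a hx h => ?_
    rw [LinearMap.comp_apply] at h ⊢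
    rw [comul_ι_mul hx, ← LinearMap.comp_apply, lTensor_counit_comp_primMul,
      LinearMap.comp_apply, h]
    rfl

end GradedLieSuperalgebra

/-! ### Symmetrization as a convolution exponential -/

section Permutations

/-- The permutation of `Fin (p + 1)` which sends `0` to `i` and the other elements, in order, to
those different from `i`, permuted by `τ`. -/
def insertPerm {p : ℕ} (i : Fin (p + 1)) (τ : Equiv.Perm (Fin p)) : Equiv.Perm (Fin (p + 1)) :=
  (finSuccEquiv p).trans (τ.optionCongr.trans (finSuccEquiv' i).symm)

@[simp] theorem insertPerm_zero {p : ℕ} (i : Fin (p + 1)) (τ : Equiv.Perm (Fin p)) :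
    insertPerm i τ 0 = i := by simp [insertPerm]

@[simp] theorem insertPerm_succ {p : ℕ} (i : Fin (p + 1)) (τ : Equiv.Perm (Fin p)) (j : Fin p) :
    insertPerm i τ j.succ = i.succAbove (τ j) := by simp [insertPerm]

theorem insertPerm_bijective (p : ℕ) : Function.Bijective
    fun a : Fin (p + 1) × Equiv.Perm (Fin p) => insertPerm a.1 a.2 := by
  rw [Fintype.bijective_iff_injective_and_card]
  refine ⟨?_, ?_⟩
  · rintro ⟨i, τ⟩ ⟨i', τ'⟩ h
    obtain rfl : i = i' := by simpa only [insertPerm_zero] using congrArg (fun σ => σ 0) h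
    refine Prod.ext rfl (Equiv.ext fun j => ?_)
    simpa only [insertPerm_succ, Fin.succAbove_right_inj] using congrArg (fun σ => σ j.succ) h
  · rw [Fintype.card_prod, Fintype.card_perm, Fintype.card_perm, Fintype.card_fin,
      Fintype.card_fin, Nat.factorial_succ]

theorem sum_perm_fin_succ {p : ℕ} {M : Type*} [AddCommMonoid M]
    (f : Equiv.Perm (Fin (p + 1)) → M) :
    ∑ σ, f σ = ∑ i, ∑ τ : Equiv.Perm (Fin p), f (insertPerm i τ) := by
  rw [← Fintype.sum_prod_type' (f := fun i τ => f (insertPerm i τ))]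
  exact (Function.Bijective.sum_comp (insertPerm_bijective p) f).symm

/-- The sign of moving the homogeneous element in position `i` to the front. -/
def frontSign {p : ℕ} (d : Fin p → Bideg) (i : Fin p) : ℤˣ :=
  ∏ j : Fin p, if j < i then koszulSign (d i) (d j) else 1

theorem frontSign_zero {p : ℕ} (d : Fin (p + 1) → Bideg) : frontSign d 0 = 1 := by
  simp [frontSign]

theorem frontSign_succ {p : ℕ} (d : Fin (p + 1) → Bideg) (i : Fin p) :
    frontSign d i.succ = koszulSign (d 0) (d i.succ) * frontSign (fun j => d j.succ) i := by
  rw [frontSign, Fin.prod_univ_succ, if_pos (Fin.succ_pos i)]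
  simp only [Fin.succ_lt_succ_iff]
  rw [koszulSign_comm]
  rfl

theorem permSign_insertPerm {p : ℕ} (d : Fin (p + 1) → Bideg) (i : Fin (p + 1))
    (τ : Equiv.Perm (Fin p)) :
    permSign d (insertPerm i τ) = frontSign d i * permSign (fun j => d (i.succAbove j)) τ := by
  rw [permSign, Fin.prod_univ_succ, Fin.prod_univ_succ]
  simp only [lt_self_iff_false, false_and, if_false, one_mul, insertPerm_zero, insertPerm_succ,
    Fin.succ_pos, true_and]
  congr 1
  · rw [Equiv.prod_comp τ fun j => if i.succAbove j < i then
      koszulSign (d i) (d (i.succAbove j)) else 1, frontSign, Fin.prod_univ_succAbove _ i]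
    simp
  · refine Finset.prod_congr rfl fun a _ => ?_
    rw [Fin.prod_univ_succ]
    simp [Fin.succ_lt_succ_iff, Fin.succAbove_lt_succAbove_iff]

end Permutations

namespace GradedLieSuperalgebra

section TensorWords

open CoalgebraStruct

variable {k g g' : Type*} [Field k] [AddCommGroup g] [Module k g] [AddCommGroup g'] [Module k g']
  (L : GradedLieSuperalgebra k g) (L' : GradedLieSuperalgebra k g')

/-- The span in `U(g) ⊗ U(g')` of the tensor products of words of homogeneous elements whose
total length belongs to `S`. -/
def tensorWords (S : Set ℕ) : Submodule k (L.U ⊗[k] L'.U) :=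
  Submodule.span k {z | ∃ l l', L.IsHomog l ∧ L'.IsHomog l' ∧ l.length + l'.length ∈ S ∧
    L.prodι l ⊗ₜ L'.prodι l' = z}

variable {L L'}

theorem prodι_tmul_prodι_mem_tensorWords {S : Set ℕ} {l : List (Bideg × g)}
    {l' : List (Bideg × g')} (hl : L.IsHomog l) (hl' : L'.IsHomog l')
    (hS : l.length + l'.length ∈ S) : L.prodι l ⊗ₜ L'.prodι l' ∈ tensorWords L L' S :=
  Submodule.subset_span ⟨l, l', hl, hl', hS, rfl⟩

theorem tensorWords_le_iff {S : Set ℕ} {W : Submodule k (L.U ⊗[k] L'.U)} :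
    tensorWords L L' S ≤ W ↔ ∀ l l', L.IsHomog l → L'.IsHomog l' → l.length + l'.length ∈ S →
      L.prodι l ⊗ₜ L'.prodι l' ∈ W := by
  rw [tensorWords, Submodule.span_le]
  constructor
  · exact fun h l l' hl hl' hS => h ⟨l, l', hl, hl', hS, rfl⟩
  · rintro h _ ⟨l, l', hl, hl', hS, rfl⟩
    exact h l l' hl hl' hS

theorem tensorWords_mono {S T : Set ℕ} (h : S ⊆ T) : tensorWords L L' S ≤ tensorWords L L' T :=
  tensorWords_le_iff.2 fun _ _ hl hl' hS => prodι_tmul_prodι_mem_tensorWords hl hl' (h hS)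

theorem primMul_mem_tensorWords {n : ℕ} {d : Bideg} {x : g} (hx : x ∈ L.comp d)
    {z : L.U ⊗[k] L.U} (hz : z ∈ tensorWords L L {n}) :
    L.primMul d x z ∈ tensorWords L L {n + 1} := by
  suffices h : tensorWords L L {n} ≤ (tensorWords L L {n + 1}).comap (L.primMul d x) from h hz
  refine tensorWords_le_iff.2 fun l l' hl hl' hn => ?_
  rw [Set.mem_singleton_iff] at hn
  rw [Submodule.mem_comap, primMul_tmul, twist_of_mem d (L.prodι_mem_grading hl)]
  have hcons {l : List (Bideg × g)} (hl : L.IsHomog l) : L.IsHomog ((d, x) :: l) :=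
    isHomog_cons.2 ⟨hx, hl⟩
  have hleft := prodι_tmul_prodι_mem_tensorWords (S := {n + 1}) (hcons hl) hl'
    (by simp only [List.length_cons, Set.mem_singleton_iff]; omega)
  have hright := prodι_tmul_prodι_mem_tensorWords (S := {n + 1}) hl (hcons hl')
    (by simp only [List.length_cons, Set.mem_singleton_iff]; omega)
  rw [prodι_cons] at hleft hright
  exact add_mem hleft (Submodule.smul_mem _ _ hright)

theorem comul_prodι_mem_tensorWords {l : List (Bideg × g)} (hl : L.IsHomog l) :
    comul (R := k) (L.prodι l) ∈ tensorWords L L {l.length} := by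
  induction l with
  | nil =>
    rw [prodι_nil, comul_one, ← prodι_nil]
    exact prodι_tmul_prodι_mem_tensorWords isHomog_nil isHomog_nil rfl
  | cons a l ih =>
    rw [isHomog_cons] at hl
    rw [prodι_cons, comul_ι_mul hl.1]
    exact primMul_mem_tensorWords hl.1 (ih hl.2)

end TensorWords

section Convolution

open CoalgebraStruct WithConv

variable {k g A : Type*} [Field k] [AddCommGroup g] [Module k g] {L : GradedLieSuperalgebra k g}
  [Ring A] [Algebra k A]

theorem conv_ext {f f' : WithConv (L.U →ₗ[k] A)}
    (h : ∀ l, L.IsHomog l → f (L.prodι l) = f' (L.prodι l)) : f = f' :=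
  ofConv_injective (L.linearMap_ext_prodι h)

theorem conv_apply_one (f h : WithConv (L.U →ₗ[k] A)) : (f * h) (1 : L.U) = f 1 * h 1 := by
  rw [LinearMap.convMul_apply, comul_one, TensorProduct.map_tmul, LinearMap.mul'_apply]

theorem conv_prodι_congr {f f' h h' : WithConv (L.U →ₗ[k] A)} {l : List (Bideg × g)}
    (hl : L.IsHomog l) (hfh : ∀ l₁ l₂, L.IsHomog l₁ → L.IsHomog l₂ →
      l₁.length + l₂.length = l.length →
        f (L.prodι l₁) * h (L.prodι l₂) = f' (L.prodι l₁) * h' (L.prodι l₂)) :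
    (f * h) (L.prodι l) = (f' * h') (L.prodι l) := by
  simp only [LinearMap.convMul_apply, ← LinearMap.comp_apply (LinearMap.mul' k A)]
  refine LinearMap.eqOn_span ?_ (comul_prodι_mem_tensorWords hl)
  rintro _ ⟨l₁, l₂, h₁, h₂, hlen, rfl⟩
  exact hfh l₁ l₂ h₁ h₂ hlen

variable (L) in
/-- A linear map on `U(g)` is concentrated in word length `n` if it vanishes on the words of
homogeneous elements of any other length. -/
def IsConcentrated (n : ℕ) (f : WithConv (L.U →ₗ[k] A)) : Prop :=
  ∀ l, L.IsHomog l → l.length ≠ n → f (L.prodι l) = 0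

theorem isConcentrated_one : L.IsConcentrated 0 (1 : WithConv (L.U →ₗ[k] A)) := fun l _ hl => by
  rw [LinearMap.convOne_apply, counit_prodι_of_ne_nil L (by simpa using hl), map_zero]

namespace IsConcentrated

variable {m n : ℕ} {f h F F' : WithConv (L.U →ₗ[k] A)}

theorem mul (hf : L.IsConcentrated m f) (hh : L.IsConcentrated n h) :
    L.IsConcentrated (m + n) (f * h) := fun l hl hlen => by
  rw [conv_prodι_congr (f' := 0) (h' := 0) hl, zero_mul]
  · rfl
  · intro l₁ l₂ h₁ h₂ h₁₂
    rcases ne_or_eq l₁.length m with hm | rfl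
    · rw [hf l₁ h₁ hm, zero_mul]
      exact (zero_mul _).symm
    · rw [hh l₂ h₂ (by omega), mul_zero]
      exact (zero_mul _).symm

theorem pow (hF : L.IsConcentrated 1 F) (n : ℕ) : L.IsConcentrated n (F ^ n) := by
  induction n with
  | zero => rw [pow_zero]; exact isConcentrated_one
  | succ n ih => rw [pow_succ]; exact ih.mul hF

theorem smul (hf : L.IsConcentrated n f) (c : k) : L.IsConcentrated n (c • f) :=
  fun l hl hlen => by
    rw [show (c • f) (L.prodι l) = c • f (L.prodι l) from rfl, hf l hl hlen, smul_zero]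

theorem comp_twist (hf : L.IsConcentrated n f) (d : Bideg) :
    L.IsConcentrated n (toConv (f.ofConv ∘ₗ twist L.grading d)) := fun l hl hlen => by
  rw [ofConv_toConv, LinearMap.comp_apply, twist_of_mem d (L.prodι_mem_grading hl), map_smul,
    hf l hl hlen, smul_zero]

theorem apply_eq_zero_of_mem_filLT (hf : L.IsConcentrated m f) (hn : n ≤ m) {u : L.U}
    (hu : u ∈ L.filLT n) : f u = 0 := by
  suffices h : L.filLT n ≤ LinearMap.ker f.ofConv from h hu
  exact L.filLT_le_iff.2 fun l hl hlen => hf l hl (by omega)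

theorem apply_one (hF : L.IsConcentrated 1 F) : F (1 : L.U) = 0 := hF [] isHomog_nil zero_ne_one

theorem apply_ι_mul (hF : L.IsConcentrated 1 F) {d : Bideg} {x : g} (hx : x ∈ L.comp d)
    (a : L.U) : F (L.ι x * a) = counit (R := k) a • F (L.ι x) := by
  refine LinearMap.congr_fun (f := F.ofConv ∘ₗ LinearMap.mulLeft k (L.ι x))
    (g := counit.smulRight (F (L.ι x))) (L.linearMap_ext_prodι fun l hl => ?_) a
  rw [LinearMap.comp_apply, LinearMap.mulLeft_apply, LinearMap.smulRight_apply]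
  rcases eq_or_ne l [] with rfl | hne
  · rw [prodι_nil, mul_one, counit_one, one_smul]
  · rw [counit_prodι_of_ne_nil L hne, zero_smul, ← L.prodι_cons (d, x)]
    exact hF _ (isHomog_cons.2 ⟨hx, hl⟩) (by simpa using hne)

theorem conv_ι_mul (hF : L.IsConcentrated 1 F) {d : Bideg} {x : g} (hx : x ∈ L.comp d)
    (a : L.U) : (F * h) (L.ι x * a) = F (L.ι x) * h a +
      (toConv (F.ofConv ∘ₗ twist L.grading d) *
        toConv (h.ofConv ∘ₗ LinearMap.mulLeft k (L.ι x))) a := by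
  have hleft (z : L.U ⊗[k] L.U) : LinearMap.mul' k A (TensorProduct.map F.ofConv h.ofConv
      (TensorProduct.map (LinearMap.mulLeft k (L.ι x)) LinearMap.id z)) =
        F (L.ι x) * h (TensorProduct.lid k L.U (counit.rTensor L.U z)) := by
    induction z using TensorProduct.induction_on with
    | zero => simp
    | add z z' hz hz' => simp only [map_add, hz, hz', mul_add]
    | tmul a b => simp [hF.apply_ι_mul hx]
  rw [LinearMap.convMul_apply, LinearMap.convMul_apply, comul_ι_mul hx, primMul,
    LinearMap.add_apply, map_add, map_add, hleft, Coalgebra.rTensor_counit_comul,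
    TensorProduct.lid_tmul, one_smul]
  congr 2
  exact (LinearMap.congr_fun (TensorProduct.map_comp _ _ _ _) (comul a)).symm

theorem conv_prodι_ofFn (hF : L.IsConcentrated 1 F) {p : ℕ} {w : Fin (p + 1) → Bideg × g}
    (hw : ∀ i, (w i).2 ∈ L.comp (w i).1) :
    (F * h) (L.prodι (List.ofFn w)) = ∑ i, frontSign (fun j => (w j).1) i •
      (F (L.ι (w i).2) * h (L.prodι (List.ofFn fun j => w (i.succAbove j)))) := by
  induction p generalizing F h with
  | zero =>
    rw [List.ofFn_succ, prodι_cons, hF.conv_ι_mul (hw 0), List.ofFn_zero, prodι_nil,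
      conv_apply_one, (hF.comp_twist _).apply_one, zero_mul, add_zero, Fin.sum_univ_one,
      frontSign_zero, one_smul, List.ofFn_zero, prodι_nil]
  | succ p ih =>
    rw [List.ofFn_succ, prodι_cons, hF.conv_ι_mul (hw 0), ih (hF.comp_twist _) fun i => hw i.succ,
      Fin.sum_univ_succ (n := p + 1), frontSign_zero, one_smul]
    congr 1
    refine Finset.sum_congr rfl fun i _ => ?_
    have hword : L.prodι (List.ofFn fun j => w (i.succ.succAbove j)) =
        L.ι (w 0).2 * L.prodι (List.ofFn fun j => w (i.succAbove j).succ) := by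
      simp [List.ofFn_succ]
    rw [hword, frontSign_succ, ofConv_toConv, LinearMap.comp_apply,
      twist_of_mem _ (L.ι_mem (hw i.succ)), map_smul, ksign_smul, smul_mul_assoc, smul_smul,
      mul_comm (koszulSign _ _)]
    rfl

theorem pow_prodι_ofFn (hF : L.IsConcentrated 1 F) {p : ℕ} {w : Fin p → Bideg × g}
    (hw : ∀ i, (w i).2 ∈ L.comp (w i).1) :
    (F ^ p) (L.prodι (List.ofFn w)) = ∑ σ : Equiv.Perm (Fin p),
      permSign (fun j => (w j).1) σ • (List.ofFn fun i => F (L.ι (w (σ i)).2)).prod := by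
  induction p with
  | zero =>
    rw [pow_zero, List.ofFn_zero, prodι_nil, LinearMap.convOne_apply, counit_one]
    simp [permSign]
  | succ p ih =>
    rw [pow_succ', hF.conv_prodι_ofFn hw, sum_perm_fin_succ]
    refine Finset.sum_congr rfl fun i _ => ?_
    rw [ih fun j => hw _, Finset.mul_sum, Finset.smul_sum]
    refine Finset.sum_congr rfl fun τ _ => ?_
    simp only [permSign_insertPerm, List.ofFn_succ, List.prod_cons, mul_smul, mul_smul_comm,
      insertPerm_zero, insertPerm_succ]

theorem conv_ι_mul_ι (hF : L.IsConcentrated 1 F) {i j : Bideg} {x y : g} (hx : x ∈ L.comp i)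
    (hy : y ∈ L.comp j) : (F * h) (L.ι x * L.ι y) =
      F (L.ι x) * h (L.ι y) + ksign k i j • (F (L.ι y) * h (L.ι x)) := by
  have htwist := (hF.comp_twist i).conv_ι_mul
    (h := toConv (h.ofConv ∘ₗ LinearMap.mulLeft k (L.ι x))) hy 1
  rw [conv_apply_one, ((hF.comp_twist i).comp_twist j).apply_one, zero_mul, add_zero,
    mul_one] at htwist
  rw [hF.conv_ι_mul hx, htwist]
  simp only [LinearMap.comp_apply, LinearMap.mulLeft_apply, mul_one,
    twist_of_mem i (L.ι_mem hy), map_smul, smul_mul_assoc]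

theorem commute_of_supercommute (hF : L.IsConcentrated 1 F) (hF' : L.IsConcentrated 1 F')
    (h : ∀ {i j : Bideg} {x y : g}, x ∈ L.comp i → y ∈ L.comp j →
      F (L.ι x) * F' (L.ι y) = ksign k i j • (F' (L.ι y) * F (L.ι x))) :
    Commute F F' := by
  refine conv_ext fun l hl => ?_
  by_cases hlen : l.length = 2
  · obtain ⟨a, b, rfl⟩ := List.length_eq_two.1 hlen
    rw [isHomog_cons, isHomog_cons] at hl
    rw [prodι_cons, prodι_cons, prodι_nil, mul_one, hF.conv_ι_mul_ι hl.1 hl.2.1,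
      hF'.conv_ι_mul_ι hl.1 hl.2.1, h hl.1 hl.2.1, h hl.2.1 hl.1, smul_smul,
      ksign_comm k b.1, ksign_mul_self, one_smul, add_comm]
  · rw [hF.mul hF' l hl hlen, hF'.mul hF l hl hlen]

end IsConcentrated

end Convolution

section Exponential

open CoalgebraStruct WithConv

variable {k g A : Type*} [Field k] [AddCommGroup g] [Module k g] {L : GradedLieSuperalgebra k g}
  [Ring A] [Algebra k A]

/-- The `n`-th term of the exponential series of `F` for the convolution product. -/
def expTerm (F : WithConv (L.U →ₗ[k] A)) (n : ℕ) : WithConv (L.U →ₗ[k] A) :=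
  (n.factorial : k)⁻¹ • F ^ n

theorem expTerm_add [CharZero k] {F F' : WithConv (L.U →ₗ[k] A)} (h : Commute F F') (n : ℕ) :
    expTerm (F + F') n =
      ∑ ij ∈ Finset.HasAntidiagonal.antidiagonal n, expTerm F ij.1 * expTerm F' ij.2 := by
  rw [expTerm, h.add_pow', Finset.smul_sum]
  refine Finset.sum_congr rfl fun ij hij => ?_
  obtain rfl := Finset.HasAntidiagonal.mem_antidiagonal.1 hij
  rw [expTerm, expTerm, smul_mul_smul_comm, ← Nat.cast_smul_eq_nsmul k, smul_smul]
  congr 1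
  rw [← Nat.add_choose_mul_factorial_mul_factorial, Nat.cast_mul, Nat.cast_mul, mul_inv, mul_inv]
  have hchoose : ((ij.1 + ij.2).choose ij.2 : k) ≠ 0 :=
    Nat.cast_ne_zero.2 (Nat.choose_pos (Nat.le_add_left _ _)).ne'
  rw [Nat.choose_symm_add]
  field_simp

namespace IsConcentrated

variable {F F' : WithConv (L.U →ₗ[k] A)}

theorem expTerm (hF : L.IsConcentrated 1 F) (n : ℕ) :
    L.IsConcentrated n (L.expTerm F n) := (hF.pow n).smul _

theorem finite_support_expTerm (hF : L.IsConcentrated 1 F) (u : L.U) :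
    (Function.support fun n => L.expTerm F n u).Finite := by
  obtain ⟨N, hN⟩ := L.exists_mem_filLT u
  refine (Set.finite_Iio N).subset fun n hn => ?_
  by_contra hNn
  exact hn ((hF.expTerm n).apply_eq_zero_of_mem_filLT (not_lt.1 hNn) hN)

/-- The exponential of a linear map concentrated in word length `1` for the convolution product.
The series is a finite sum at every element of `U(g)`. -/
def convExp (hF : L.IsConcentrated 1 F) : WithConv (L.U →ₗ[k] A) := toConv
  { toFun u := ∑ᶠ n, L.expTerm F n u
    map_add' u v := by
      simp only [map_add]
      exact finsum_add_distrib (hF.finite_support_expTerm u) (hF.finite_support_expTerm v)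
    map_smul' c u := by
      simp only [map_smul, RingHom.id_apply]
      exact (smul_finsum c _).symm }

theorem convExp_prodι (hF : L.IsConcentrated 1 F) {l : List (Bideg × g)} (hl : L.IsHomog l) :
    hF.convExp (L.prodι l) = L.expTerm F l.length (L.prodι l) :=
  finsum_eq_single _ _ fun n hn => hF.expTerm n l hl hn.symm

theorem add (hF : L.IsConcentrated 1 F) (hF' : L.IsConcentrated 1 F') :
    L.IsConcentrated 1 (F + F') := fun l hl hlen => by
  rw [show (F + F') (L.prodι l) = F (L.prodι l) + F' (L.prodι l) from rfl, hF l hl hlen,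
    hF' l hl hlen, add_zero]

theorem convExp_add [CharZero k] (hF : L.IsConcentrated 1 F) (hF' : L.IsConcentrated 1 F')
    (h : Commute F F') : (hF.add hF').convExp = hF.convExp * hF'.convExp := by
  refine conv_ext fun l hl => ?_
  have hsum : Set.EqOn
      (∑ ij ∈ Finset.HasAntidiagonal.antidiagonal l.length, LinearMap.mul' k A ∘ₗ
        TensorProduct.map (L.expTerm F ij.1).ofConv (L.expTerm F' ij.2).ofConv :
          L.U ⊗[k] L.U →ₗ[k] A)
      (LinearMap.mul' k A ∘ₗ TensorProduct.map hF.convExp.ofConv hF'.convExp.ofConv)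
      (tensorWords L L {l.length}) := by
    refine LinearMap.eqOn_span ?_
    rintro _ ⟨l₁, l₂, h₁, h₂, hlen, rfl⟩
    simp only [LinearMap.sum_apply, LinearMap.comp_apply, TensorProduct.map_tmul,
      LinearMap.mul'_apply, hF.convExp_prodι h₁, hF'.convExp_prodι h₂]
    refine Finset.sum_eq_single_of_mem (l₁.length, l₂.length)
      (Finset.HasAntidiagonal.mem_antidiagonal.2 hlen) fun ij _ hne => ?_
    rcases ne_or_eq l₁.length ij.1 with hi | hi
    · rw [hF.expTerm _ l₁ h₁ hi, zero_mul]
    · rw [hF'.expTerm _ l₂ h₂ fun hj => hne (Prod.ext hi.symm hj.symm), mul_zero]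
  rw [convExp_prodι _ hl, expTerm_add h, ofConv_sum, LinearMap.sum_apply, LinearMap.convMul_apply,
    ← LinearMap.comp_apply, ← hsum (comul_prodι_mem_tensorWords hl), LinearMap.sum_apply]
  rfl

end IsConcentrated

end Exponential

end GradedLieSuperalgebra

namespace GradedSuperspace

open WithConv GradedLieSuperalgebra

section Projection

variable {k V : Type*} [Field k] [AddCommGroup V] [Module k V] (G : GradedSuperspace k V)

/-- The algebra map from `Sym(V)` to the square zero extension of `k` by `V` which is the identity
on `V`. -/
def symToTrivSqZeroExt [Module kᵐᵒᵖ V] [IsCentralScalar k V] : G.Sym →ₐ[k] TrivSqZeroExt k V :=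
  G.abelian.lift (TrivSqZeroExt.inrHom k V) fun _ _ => by simp [abelian]

/-- The projection of `Sym(V)` to `V`. -/
def symProj : G.Sym →ₗ[k] V :=
  letI : Module kᵐᵒᵖ V := Module.compHom _ ((RingHom.id k).fromOpposite mul_comm)
  haveI : IsCentralScalar k V := ⟨fun _ _ => rfl⟩
  TrivSqZeroExt.sndHom k V ∘ₗ G.symToTrivSqZeroExt.toLinearMap

variable {G}

theorem symToTrivSqZeroExt_ι [Module kᵐᵒᵖ V] [IsCentralScalar k V] (x : V) :
    G.symToTrivSqZeroExt (G.symι x) = TrivSqZeroExt.inr x :=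
  G.abelian.lift_ι (TrivSqZeroExt.inrHom k V) (fun _ _ => by simp [abelian]) x

theorem symToTrivSqZeroExt_prodι_of_length_ne_one [Module kᵐᵒᵖ V] [IsCentralScalar k V]
    {l : List (Bideg × V)} (hl : l.length ≠ 1) :
    (G.symToTrivSqZeroExt (G.abelian.prodι l)).snd = 0 := by
  match l with
  | [] => rw [prodι_nil, map_one, TrivSqZeroExt.snd_one]
  | a :: b :: l =>
    rw [prodι_cons, prodι_cons, ← mul_assoc, map_mul, map_mul, symToTrivSqZeroExt_ι,
      symToTrivSqZeroExt_ι, TrivSqZeroExt.inr_mul_inr, zero_mul, TrivSqZeroExt.snd_zero]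

theorem symProj_ι (x : V) : G.symProj (G.symι x) = x :=
  letI : Module kᵐᵒᵖ V := Module.compHom _ ((RingHom.id k).fromOpposite mul_comm)
  haveI : IsCentralScalar k V := ⟨fun _ _ => rfl⟩
  congrArg TrivSqZeroExt.snd (G.symToTrivSqZeroExt_ι x)

theorem symProj_prodι_of_length_ne_one {l : List (Bideg × V)} (hl : l.length ≠ 1) :
    G.symProj (G.abelian.prodι l) = 0 :=
  letI : Module kᵐᵒᵖ V := Module.compHom _ ((RingHom.id k).fromOpposite mul_comm)
  haveI : IsCentralScalar k V := ⟨fun _ _ => rfl⟩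
  symToTrivSqZeroExt_prodι_of_length_ne_one hl

end Projection

variable {k V A B : Type*} [Field k] [AddCommGroup V] [Module k V] (G : GradedSuperspace k V)
  [Ring A] [Algebra k A] [Ring B] [Algebra k B]

theorem isConcentrated_comp_symProj (f : V →ₗ[k] A) :
    G.abelian.IsConcentrated 1 (toConv (f ∘ₗ G.symProj)) := fun l _ hlen => by
  rw [ofConv_toConv, LinearMap.comp_apply, symProj_prodι_of_length_ne_one hlen, map_zero]

/-- The symmetrization map `Sym(V) → A` of a linear map `f : V → A` to an algebra, obtained as the
exponential of `f` for the convolution product. -/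
def symmetrize (f : V →ₗ[k] A) : G.Sym →ₗ[k] A := (G.isConcentrated_comp_symProj f).convExp.ofConv

variable {G}

theorem symmetrize_prodι_ofFn (f : V →ₗ[k] A) {p : ℕ} {w : Fin p → Bideg × V}
    (hw : ∀ i, (w i).2 ∈ G.comp (w i).1) : G.symmetrize f (G.abelian.prodι (List.ofFn w)) =
      (p.factorial : k)⁻¹ • ∑ σ : Equiv.Perm (Fin p),
        permSign (fun i => (w i).1) σ • (List.ofFn fun i => f (w (σ i)).2).prod := by
  have hF := G.isConcentrated_comp_symProj f
  have hpow := hF.pow_prodι_ofFn hw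
  simp only [LinearMap.comp_apply, symProj_ι] at hpow
  have hl : G.abelian.IsHomog (List.ofFn w) := fun a ha => by
    obtain ⟨i, rfl⟩ := List.mem_ofFn.1 ha
    exact hw i
  rw [symmetrize, hF.convExp_prodι hl, List.length_ofFn, ← hpow]
  rfl

theorem symmetrize_prodι (f : V →ₗ[k] A) {l : List (Bideg × V)} (hl : G.abelian.IsHomog l) :
    G.symmetrize f (G.abelian.prodι l) =
      (l.length.factorial : k)⁻¹ • ∑ σ : Equiv.Perm (Fin l.length),
        permSign (fun i => (l.get i).1) σ • (List.ofFn fun i => f (l.get (σ i)).2).prod := by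
  conv_lhs => rw [← List.ofFn_get l]
  exact symmetrize_prodι_ofFn f fun i => hl _ (List.get_mem l i)

theorem symmetrize_comp (f : V →ₗ[k] A) (h : A →ₐ[k] B) :
    G.symmetrize (h.toLinearMap ∘ₗ f) = h.toLinearMap ∘ₗ G.symmetrize f := by
  refine G.abelian.linearMap_ext_prodι fun l hl => ?_
  rw [LinearMap.comp_apply, symmetrize_prodι _ hl, symmetrize_prodι _ hl]
  simp only [map_smul, map_sum, Units.smul_def, map_zsmul, AlgHom.toLinearMap_apply,
    map_list_prod, List.map_ofFn]
  rfl

theorem symmetrize_add [CharZero k] {f f' : V →ₗ[k] A}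
    (h : ∀ {i j : Bideg} {x y : V}, x ∈ G.comp i → y ∈ G.comp j →
      f x * f' y = ksign k i j • (f' y * f x)) :
    toConv (G.symmetrize (f + f')) = toConv (G.symmetrize f) * toConv (G.symmetrize f') := by
  have hF := G.isConcentrated_comp_symProj f
  have hF' := G.isConcentrated_comp_symProj f'
  have hcomm : Commute (toConv (f ∘ₗ G.symProj)) (toConv (f' ∘ₗ G.symProj)) :=
    hF.commute_of_supercommute hF' fun hx hy => by
      simpa only [ofConv_toConv, LinearMap.comp_apply, symProj_ι] using h hx hy
  exact hF.convExp_add hF' hcomm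

theorem symmetrize_one (f : V →ₗ[k] A) : G.symmetrize f 1 = 1 := by
  have := symmetrize_prodι (G := G) f isHomog_nil
  simpa [permSign] using this

end GradedSuperspace

/-! ### Compatibility of symmetrization with comultiplication -/

section GradedTensor

variable {k A B : Type*} [Field k] [Ring A] [Ring B] [Algebra k A] [Algebra k B]
  (𝒜 : Bideg → Submodule k A) (ℬ : Bideg → Submodule k B) [GradedAlgebra 𝒜] [GradedAlgebra ℬ]

theorem superSwap_tmul {i j : Bideg} {a : A} {b : B} (ha : a ∈ 𝒜 i) (hb : b ∈ ℬ j) :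
    superSwap 𝒜 ℬ (a ⊗ₜ b) = ksign k i j • b ⊗ₜ[k] a := by
  have h := GradedTensorProduct.comm_coe_tmul_coe (R := k) 𝒜 ℬ ⟨a, ha⟩ ⟨b, hb⟩
  rw [uzpow_bideg, ← ksign_smul k, ksign_comm] at h
  exact h

theorem superMiddleSwap_tmul {i j : Bideg} (a : A) {a' : A} {b : B} (b' : B) (ha : a' ∈ 𝒜 i)
    (hb : b ∈ ℬ j) : superMiddleSwap 𝒜 ℬ ((a ⊗ₜ a') ⊗ₜ (b ⊗ₜ b')) =
      ksign k i j • ((a ⊗ₜ[k] b) ⊗ₜ[k] (a' ⊗ₜ[k] b')) := by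
  simp [superMiddleSwap, superSwap_tmul 𝒜 ℬ ha hb, TensorProduct.smul_tmul',
    TensorProduct.tmul_smul]

open GradedTensorProduct

variable {𝒜 ℬ} in
theorem includeLeft_mul_includeRight {i j : Bideg} {a : A} {b : B} (ha : a ∈ 𝒜 i) (hb : b ∈ ℬ j) :
    includeLeft (R := k) 𝒜 ℬ a * includeRight 𝒜 ℬ b =
      ksign k i j • (includeRight 𝒜 ℬ b * includeLeft 𝒜 ℬ a) := by
  have h := gradedTensor_mul_of_mem 𝒜 ℬ 1 hb ha 1
  rw [one_mul, mul_one] at h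
  simp only [includeLeft_apply, includeRight_apply]
  rw [h, smul_smul, ksign_comm k j, ksign_mul_self, one_smul]
  exact tmul_one_mul_one_tmul (R := k) 𝒜 ℬ a b

theorem mul'_map_includeLeft_includeRight {X Y : Type*} [AddCommGroup X] [Module k X]
    [AddCommGroup Y] [Module k Y] (f : X →ₗ[k] A) (h : Y →ₗ[k] B) (z : X ⊗[k] Y) :
    LinearMap.mul' k _ (TensorProduct.map ((includeLeft (R := k) 𝒜 ℬ).toLinearMap ∘ₗ f)
      ((includeRight 𝒜 ℬ).toLinearMap ∘ₗ h) z) = of k 𝒜 ℬ (TensorProduct.map f h z) := by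
  induction z using TensorProduct.induction_on with
  | zero => simp
  | add z z' hz hz' => simp only [map_add, hz, hz']
  | tmul x y => exact tmul_one_mul_one_tmul (R := k) 𝒜 ℬ (f x) (h y)

variable {C : Type*} [Ring C] [Algebra k C] (𝒞 : Bideg → Submodule k C) [GradedAlgebra 𝒞]

theorem gradedTensor_map_mul_map {f : A →ₗ[k] C} {h : B →ₗ[k] C}
    (hf : ∀ (d : Bideg) (a : A), a ∈ 𝒜 d → f a ∈ 𝒞 d)
    (hh : ∀ (d : Bideg) (b : B), b ∈ ℬ d → h b ∈ 𝒞 d) (z : A ⊗[k] A) (w : B ⊗[k] B) :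
    (of k 𝒞 𝒞 (TensorProduct.map f f z) * of k 𝒞 𝒞 (TensorProduct.map h h w) : 𝒞 ᵍ⊗[k] 𝒞) =
      of k 𝒞 𝒞 (TensorProduct.map (LinearMap.mul' k C ∘ₗ TensorProduct.map f h)
        (LinearMap.mul' k C ∘ₗ TensorProduct.map f h) (superMiddleSwap 𝒜 ℬ (z ⊗ₜ w))) := by
  induction z using TensorProduct.induction_on with
  | zero => simp
  | add z z' hz hz' => simp only [map_add, add_mul, TensorProduct.add_tmul, hz, hz']
  | tmul a a' =>
  induction w using TensorProduct.induction_on with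
  | zero => simp
  | add z z' hz hz' => simp only [map_add, mul_add, TensorProduct.tmul_add, hz, hz']
  | tmul b b' =>
  induction a' using DirectSum.Decomposition.inductionOn 𝒜 with
  | zero => simp
  | add z z' hz hz' =>
    simp only [map_add, add_mul, TensorProduct.add_tmul, TensorProduct.tmul_add, hz, hz']
  | homogeneous a' =>
  induction b using DirectSum.Decomposition.inductionOn ℬ with
  | zero => simp
  | add z z' hz hz' =>
    simp only [map_add, mul_add, TensorProduct.add_tmul, TensorProduct.tmul_add, hz, hz']
  | homogeneous b =>
  rw [superMiddleSwap_tmul 𝒜 ℬ a b' a'.2 b.2, TensorProduct.map_tmul, TensorProduct.map_tmul,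
    map_smul, map_smul]
  exact gradedTensor_mul_of_mem 𝒞 𝒞 (f a) (hf _ _ a'.2) (hh _ _ b.2) (h b')

end GradedTensor

namespace GradedLieSuperalgebra

open CoalgebraStruct

section Functoriality

variable {k g g' : Type*} [Field k] [AddCommGroup g] [Module k g] [AddCommGroup g'] [Module k g']
  {L : GradedLieSuperalgebra k g} {L' : GradedLieSuperalgebra k g'} {f : g →ₗ[k] g'}
  {F : L.U →ₐ[k] L'.U}

theorem grading_le_iff {d : Bideg} {W : Submodule k L.U} : L.grading d ≤ W ↔
    ∀ l, L.IsHomog l → (l.map Prod.fst).sum = d → L.prodι l ∈ W := by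
  rw [grading, Submodule.span_le]
  constructor
  · exact fun h l hl hd => h ⟨l, hl, hd, rfl⟩
  · rintro h _ ⟨l, hl, hd, rfl⟩
    exact h l hl hd

theorem IsHomog.map (hf : ∀ d x, x ∈ L.comp d → f x ∈ L'.comp d) {l : List (Bideg × g)}
    (hl : L.IsHomog l) : L'.IsHomog (l.map (Prod.map id f)) := fun a ha => by
  obtain ⟨b, hb, rfl⟩ := List.mem_map.1 ha
  exact hf _ _ (hl b hb)

theorem IsHomog.ofFn {p : ℕ} {w : Fin p → Bideg × g} (hw : ∀ i, (w i).2 ∈ L.comp (w i).1) :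
    L.IsHomog (List.ofFn w) := fun a ha => by
  obtain ⟨i, rfl⟩ := List.mem_ofFn.1 ha
  exact hw i

theorem algHom_prodι (hF : ∀ x, F (L.ι x) = L'.ι (f x)) (l : List (Bideg × g)) :
    F (L.prodι l) = L'.prodι (l.map (Prod.map id f)) := by
  simp only [prodι, map_list_prod, List.map_map]
  congr 2
  exact funext fun a => hF a.2

theorem algHom_mem_grading (hF : ∀ x, F (L.ι x) = L'.ι (f x))
    (hf : ∀ d x, x ∈ L.comp d → f x ∈ L'.comp d) (d : Bideg) (a : L.U) (ha : a ∈ L.grading d) :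
    F a ∈ L'.grading d := by
  suffices h : L.grading d ≤ (L'.grading d).comap F.toLinearMap from h ha
  refine grading_le_iff.2 fun l hl hd => ?_
  rw [Submodule.mem_comap, AlgHom.toLinearMap_apply, algHom_prodι hF]
  have hdeg : ((l.map (Prod.map id f)).map Prod.fst).sum = d := by
    rw [← hd, List.map_map]
    rfl
  exact hdeg ▸ L'.prodι_mem_grading (hl.map hf)

theorem counit_algHom (hF : ∀ x, F (L.ι x) = L'.ι (f x)) (a : L.U) :
    counit (R := k) (F a) = counit (R := k) a := by
  refine LinearMap.congr_fun (f := counit ∘ₗ F.toLinearMap) (g := counit)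
    (L.linearMap_ext_ι_mul ?_ fun d x a _ _ => ?_) a
  · simp [counit_one]
  · simp only [LinearMap.comp_apply, AlgHom.toLinearMap_apply, map_mul, hF, counit_ι_mul]

theorem comul_algHom (hF : ∀ x, F (L.ι x) = L'.ι (f x))
    (hf : ∀ d x, x ∈ L.comp d → f x ∈ L'.comp d) (a : L.U) : comul (R := k) (F a) =
      TensorProduct.map F.toLinearMap F.toLinearMap (comul a) := by
  have hmul {d : Bideg} (x : g) : TensorProduct.map F.toLinearMap F.toLinearMap ∘ₗ
      L.primMul d x = L'.primMul d (f x) ∘ₗ TensorProduct.map F.toLinearMap F.toLinearMap :=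
    TensorProduct.ext' fun a b => by
      have htwist := map_twist L.grading (f := F.toLinearMap) (algHom_mem_grading hF hf) d a
      rw [AlgHom.toLinearMap_apply, AlgHom.toLinearMap_apply] at htwist
      simp [primMul_tmul, hF, htwist]
  refine LinearMap.congr_fun (f := comul ∘ₗ F.toLinearMap)
    (g := TensorProduct.map F.toLinearMap F.toLinearMap ∘ₗ comul)
    (L.linearMap_ext_ι_mul ?_ fun d x a hx h => ?_) a
  · simp [comul_one]
  · simp only [LinearMap.comp_apply, AlgHom.toLinearMap_apply, map_mul, hF] at h ⊢
    rw [comul_ι_mul (hf d x hx), comul_ι_mul hx, h]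
    exact (LinearMap.congr_fun (hmul x) _).symm

end Functoriality

end GradedLieSuperalgebra

namespace GradedSuperspace

open CoalgebraStruct WithConv GradedLieSuperalgebra

variable {k V g : Type*} [Field k] [AddCommGroup V] [Module k V] {G : GradedSuperspace k V}
  [AddCommGroup g] [Module k g] {L : GradedLieSuperalgebra k g} {f : V →ₗ[k] g}

theorem symmetrize_ι_comp_prodι {l : List (Bideg × V)} (hl : G.abelian.IsHomog l) :
    G.symmetrize (L.ι ∘ₗ f) (G.abelian.prodι l) = (l.length.factorial : k)⁻¹ •
      ∑ σ : Equiv.Perm (Fin l.length), permSign (fun i => (l.get i).1) σ •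
        L.prodι (List.ofFn fun i => Prod.map id f (l.get (σ i))) := by
  rw [symmetrize_prodι _ hl]
  simp only [prodι, List.map_ofFn]
  rfl

theorem symmetrize_mem_grading (hf : ∀ d x, x ∈ G.comp d → f x ∈ L.comp d) (d : Bideg)
    (s : G.Sym) (hs : s ∈ G.symGrading d) : G.symmetrize (L.ι ∘ₗ f) s ∈ L.grading d := by
  suffices h : G.symGrading d ≤ (L.grading d).comap (G.symmetrize (L.ι ∘ₗ f)) from h hs
  refine grading_le_iff.2 fun l hl hd => ?_
  rw [Submodule.mem_comap, symmetrize_ι_comp_prodι hl]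
  refine Submodule.smul_mem _ _ (Submodule.sum_mem _ fun σ _ => ?_)
  rw [← intCast_units_smul (k := k)]
  refine Submodule.smul_mem _ _ ?_
  have hhomog : L.IsHomog (List.ofFn fun i => Prod.map id f (l.get (σ i))) :=
    .ofFn fun i => hf _ _ (hl _ (List.get_mem l (σ i)))
  have hdeg : ((List.ofFn fun i => Prod.map id f (l.get (σ i))).map Prod.fst).sum = d := by
    conv_rhs => rw [← hd, ← List.ofFn_get l, List.map_ofFn, List.sum_ofFn]
    rw [List.map_ofFn, List.sum_ofFn]
    exact Equiv.sum_comp σ fun i => (l.get i).1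
  exact hdeg ▸ L.prodι_mem_grading hhomog

theorem counit_symmetrize (s : G.Sym) :
    counit (R := k) (G.symmetrize (L.ι ∘ₗ f) s) = counit (R := k) s := by
  refine LinearMap.congr_fun (f := counit ∘ₗ G.symmetrize (L.ι ∘ₗ f)) (g := counit)
    (G.abelian.linearMap_ext_prodι fun l hl => ?_) s
  rw [LinearMap.comp_apply]
  rcases eq_or_ne l [] with rfl | hne
  · rw [prodι_nil, symmetrize_one, counit_one, counit_one]
  · rw [counit_prodι_of_ne_nil _ hne, symmetrize_ι_comp_prodι hl, map_smul, map_sum,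
      Finset.sum_eq_zero, smul_zero]
    intro σ _
    rw [← intCast_units_smul (k := k), map_smul, counit_prodι_of_ne_nil, smul_zero]
    simpa [List.ofFn_eq_nil_iff] using hne

/-- Symmetrization turns the sum `x ⊗ 1 + 1 ⊗ x` of two supercommuting maps into a convolution
product, which is the comultiplication. -/
theorem comul_symmetrize [CharZero k] (hf : ∀ d x, x ∈ G.comp d → f x ∈ L.comp d) (s : G.Sym) :
    comul (R := k) (G.symmetrize (L.ι ∘ₗ f) s) =
      TensorProduct.map (G.symmetrize (L.ι ∘ₗ f)) (G.symmetrize (L.ι ∘ₗ f)) (comul s) := by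
  let left := (GradedTensorProduct.includeLeft (R := k) L.grading L.grading).toLinearMap
  let right := (GradedTensorProduct.includeRight (R := k) L.grading L.grading).toLinearMap
  have hprimitive : L.comulAlgHom.toLinearMap ∘ₗ (L.ι ∘ₗ f) =
      left ∘ₗ (L.ι ∘ₗ f) + right ∘ₗ (L.ι ∘ₗ f) := LinearMap.ext fun x => L.comulAlgHom_ι (f x)
  have hconv := symmetrize_add (G := G) (f := left ∘ₗ (L.ι ∘ₗ f)) (f' := right ∘ₗ (L.ι ∘ₗ f))
    fun hx hy => includeLeft_mul_includeRight (L.ι_mem (hf _ _ hx)) (L.ι_mem (hf _ _ hy))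
  rw [← hprimitive, symmetrize_comp, symmetrize_comp, symmetrize_comp] at hconv
  rw [comul_def, LinearEquiv.symm_apply_eq, ← mul'_map_includeLeft_includeRight]
  exact LinearMap.congr_fun (congrArg WithConv.ofConv hconv) s

end GradedSuperspace

namespace GradedLieSubalgebra

open CoalgebraStruct GradedLieSuperalgebra GradedSuperspace

variable {k g : Type*} [Field k] [AddCommGroup g] [Module k g] {L : GradedLieSuperalgebra k g}
  (H : GradedLieSubalgebra L)

theorem incl_ι (x : H.carrier) : H.incl (H.toLie.ι x) = L.ι (H.carrier.subtype x) :=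
  H.toLie.lift_ι (L.ι ∘ₗ H.carrier.subtype) (fun hx hy => L.ι_mul_ι hx hy) x

theorem incl_mem_grading (d : Bideg) (a : H.toLie.U) (ha : a ∈ H.toLie.grading d) :
    H.incl a ∈ L.grading d :=
  algHom_mem_grading H.incl_ι (fun _ _ hx => hx) d a ha

variable (M : GradedSubspace L.toGradedSuperspace)

/-- The map `a ⊗ y₁ ⊙ ⋯ ⊙ yₚ ↦ a · (1 / p!) ∑ ± y_σ(1) ⋯ y_σ(p)` from `U(h) ⊗ Sym(m)` to `U(g)`,
for a graded subalgebra `h` and a graded subspace `m` of `g`. -/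
def mulSymmetrize : H.toLie.U ⊗[k] M.toSuperspace.Sym →ₗ[k] L.U :=
  LinearMap.mul' k L.U ∘ₗ TensorProduct.map H.incl.toLinearMap
    (M.toSuperspace.symmetrize (L.ι ∘ₗ M.carrier.subtype))

theorem mulSymmetrize_tmul (a : H.toLie.U) (s : M.toSuperspace.Sym) :
    H.mulSymmetrize M (a ⊗ₜ s) =
      H.incl a * M.toSuperspace.symmetrize (L.ι ∘ₗ M.carrier.subtype) s := rfl

theorem counit_mulSymmetrize_tmul (a : H.toLie.U) (s : M.toSuperspace.Sym) :
    counit (R := k) (H.mulSymmetrize M (a ⊗ₜ s)) = counit (R := k) a * counit (R := k) s := by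
  rw [← counit_algHom H.incl_ι, ← counit_symmetrize (L := L) (f := M.carrier.subtype) s]
  exact map_mul L.counitAlgHom _ _

theorem comul_mulSymmetrize_tmul [CharZero k] (a : H.toLie.U) (s : M.toSuperspace.Sym) :
    comul (R := k) (H.mulSymmetrize M (a ⊗ₜ s)) =
      TensorProduct.map (H.mulSymmetrize M) (H.mulSymmetrize M)
        (superMiddleSwap H.toLie.grading M.toSuperspace.symGrading (comul a ⊗ₜ comul s)) := by
  have hmul := gradedTensor_map_mul_map H.toLie.grading M.toSuperspace.symGrading L.grading
    (f := H.incl.toLinearMap) H.incl_mem_grading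
    (h := M.toSuperspace.symmetrize (L.ι ∘ₗ M.carrier.subtype))
    (symmetrize_mem_grading fun _ _ hy => hy) (comul a) (comul s)
  rw [← comul_algHom H.incl_ι fun _ _ hx => hx, ← comul_symmetrize fun _ _ hy => hy] at hmul
  rw [comul_def, mulSymmetrize_tmul, map_mul, LinearEquiv.symm_apply_eq]
  exact hmul

end GradedLieSubalgebra

/-! ### Leading terms -/

namespace GradedLieSuperalgebra

section Permutations

variable {k g : Type*} [Field k] [AddCommGroup g] [Module k g] {L : GradedLieSuperalgebra k g}

theorem frontSign_smul_sub_mem_filLT {p : ℕ} {w : Fin (p + 1) → Bideg × g}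
    (hw : ∀ i, (w i).2 ∈ L.comp (w i).1) (i : Fin (p + 1)) :
    frontSign (fun j => (w j).1) i •
        (L.ι (w i).2 * L.prodι (List.ofFn fun j => w (i.succAbove j))) -
      L.prodι (List.ofFn w) ∈ L.filLT (p + 1) := by
  induction p with
  | zero => simp [Fin.fin_one_eq_zero i, frontSign_zero]
  | succ p ih =>
    cases i using Fin.cases with
    | zero => simp [frontSign_zero]
    | succ i =>
      set rest := L.prodι (List.ofFn fun j => w (i.succAbove j).succ)
      have hswap := L.ksign_smul_ι_mul_ι_mul_sub_mem_filLT (hw i.succ) (hw 0)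
        (L.prodι_mem_filLT (.ofFn fun j => hw (i.succAbove j).succ) (by simp) :
          rest ∈ L.filLT (p + 1))
      rw [ksign_smul, koszulSign_comm] at hswap
      have htail := L.ι_mul_mem_filLT (w 0).2 (ih (w := fun j => w j.succ) (fun j => hw j.succ) i)
      have hsum := add_mem (Submodule.smul_of_tower_mem (L.filLT (p + 2))
        (frontSign (fun j => (w j.succ).1) i) hswap) htail
      rw [frontSign_succ, List.ofFn_succ, List.ofFn_succ (f := w)]
      simp only [Fin.succ_succAbove_zero, Fin.succ_succAbove_succ, prodι_cons]
      convert hsum using 1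
      rw [mul_sub, mul_smul_comm, smul_sub, smul_smul, mul_comm (koszulSign _ _),
        sub_add_sub_cancel]

theorem permSign_smul_sub_mem_filLT {p : ℕ} {w : Fin p → Bideg × g}
    (hw : ∀ i, (w i).2 ∈ L.comp (w i).1) (σ : Equiv.Perm (Fin p)) :
    permSign (fun i => (w i).1) σ • L.prodι (List.ofFn fun i => w (σ i)) -
      L.prodι (List.ofFn w) ∈ L.filLT p := by
  induction p with
  | zero => simp [permSign]
  | succ p ih =>
    obtain ⟨⟨i, τ⟩, rfl⟩ := (insertPerm_bijective p).2 σ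
    have hsum := add_mem (Submodule.smul_of_tower_mem (L.filLT (p + 1))
        (frontSign (fun j => (w j).1) i) (L.ι_mul_mem_filLT (w i).2
          (ih (w := fun j => w (i.succAbove j)) (fun j => hw _) τ)))
      (frontSign_smul_sub_mem_filLT hw i)
    rw [permSign_insertPerm, List.ofFn_succ]
    simp only [insertPerm_zero, insertPerm_succ, prodι_cons]
    convert hsum using 1
    rw [mul_sub, mul_smul_comm, smul_sub, smul_smul, sub_add_sub_cancel]

end Permutations

section Symbol

variable {k g g' : Type*} [Field k] [AddCommGroup g] [Module k g] [AddCommGroup g'] [Module k g']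
  {L : GradedLieSuperalgebra k g} {L' : GradedLieSuperalgebra k g'}

variable (L L') in
/-- A linear map `T : U(g) → U(g')` has symbol `f : g → g'` when `T (x₁ ⋯ xₙ)` agrees with
`f x₁ ⋯ f xₙ`, for homogeneous `xᵢ`, up to products of fewer than `n` elements. -/
def HasSymbol (T : L.U →ₗ[k] L'.U) (f : g →ₗ[k] g') : Prop :=
  ∀ l, L.IsHomog l → T (L.prodι l) - L'.prodι (l.map (Prod.map id f)) ∈ L'.filLT l.length

variable {T : L.U →ₗ[k] L'.U} {f : g →ₗ[k] g'}

theorem HasSymbol.mem_filLT (hT : HasSymbol L L' T f) (hf : ∀ d x, x ∈ L.comp d → f x ∈ L'.comp d)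
    (n : ℕ) (u : L.U) (hu : u ∈ L.filLT n) : T u ∈ L'.filLT n := by
  suffices h : L.filLT n ≤ (L'.filLT n).comap T from h hu
  refine L.filLT_le_iff.2 fun l hl hn => ?_
  rw [Submodule.mem_comap, ← sub_add_cancel (T _)]
  exact add_mem (L'.filLT_mono hn.le (hT l hl))
    (L'.prodι_mem_filLT (hl.map hf) (by rwa [List.length_map]))

theorem hasSymbol_algHom {F : L.U →ₐ[k] L'.U} (hF : ∀ x, F (L.ι x) = L'.ι (f x)) :
    HasSymbol L L' F.toLinearMap f := fun l _ => by
  rw [AlgHom.toLinearMap_apply, algHom_prodι hF, sub_self]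
  exact zero_mem _

theorem hasSymbol_symmetrize [CharZero k] {V : Type*} [AddCommGroup V] [Module k V]
    {G : GradedSuperspace k V} {f : V →ₗ[k] g} (hf : ∀ d y, y ∈ G.comp d → f y ∈ L.comp d) :
    HasSymbol G.abelian L (G.symmetrize (L.ι ∘ₗ f)) f := by
  intro l hl
  have hfactorial : (l.length.factorial : k) ≠ 0 := Nat.cast_ne_zero.2 (Nat.factorial_ne_zero _)
  have hconst : L.prodι (l.map (Prod.map id f)) = (l.length.factorial : k)⁻¹ •
      ∑ _σ : Equiv.Perm (Fin l.length),
        L.prodι (List.ofFn fun i => Prod.map id f (l.get i)) := by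
    rw [Finset.sum_const, Finset.card_univ, Fintype.card_perm, Fintype.card_fin,
      ← Nat.cast_smul_eq_nsmul k, smul_smul, inv_mul_cancel₀ hfactorial, one_smul]
    conv_lhs => rw [← List.ofFn_get l, List.map_ofFn]
    rfl
  rw [hconst, GradedSuperspace.symmetrize_ι_comp_prodι hl, ← smul_sub, ← Finset.sum_sub_distrib]
  exact Submodule.smul_mem _ _ (Submodule.sum_mem _ fun σ _ => permSign_smul_sub_mem_filLT
    (w := fun i => Prod.map id f (l.get i)) (fun i => hf _ _ (hl _ (List.get_mem l i))) σ)

theorem hasSymbol_symmetrize_ι [CharZero k] (L : GradedLieSuperalgebra k g) :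
    HasSymbol L.toGradedSuperspace.abelian L (L.toGradedSuperspace.symmetrize L.ι) LinearMap.id :=
  hasSymbol_symmetrize (f := LinearMap.id) fun _ _ hx => hx

end Symbol

section TensorWords

variable {k g₁ g₂ h₁ h₂ : Type*} [Field k] [AddCommGroup g₁] [Module k g₁] [AddCommGroup g₂]
  [Module k g₂] [AddCommGroup h₁] [Module k h₁] [AddCommGroup h₂] [Module k h₂]
  {L₁ : GradedLieSuperalgebra k g₁} {L₂ : GradedLieSuperalgebra k g₂}
  {N₁ : GradedLieSuperalgebra k h₁} {N₂ : GradedLieSuperalgebra k h₂}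

theorem tmul_mem_tensorWords {m n N : ℕ} {a : L₁.U} {b : L₂.U} (ha : a ∈ L₁.filLT m)
    (hb : b ∈ L₂.filLT n) (h : m + n ≤ N + 1) : a ⊗ₜ b ∈ tensorWords L₁ L₂ (Set.Iio N) := by
  suffices hle : L₁.filLT m ≤ (tensorWords L₁ L₂ (Set.Iio N)).comap
      ((TensorProduct.mk k L₁.U L₂.U).flip b) from hle ha
  refine L₁.filLT_le_iff.2 fun l hl hm => ?_
  suffices hle : L₂.filLT n ≤ (tensorWords L₁ L₂ (Set.Iio N)).comap
      (TensorProduct.mk k L₁.U L₂.U (L₁.prodι l)) from hle hb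
  refine L₂.filLT_le_iff.2 fun l' hl' hn => prodι_tmul_prodι_mem_tensorWords hl hl' ?_
  rw [Set.mem_Iio]
  omega

theorem tensorWords_Iio_zero : tensorWords L₁ L₂ (Set.Iio 0) = ⊥ :=
  le_bot_iff.1 (tensorWords_le_iff.2 fun _ _ _ _ h => absurd h (Nat.not_lt_zero _))

theorem exists_mem_tensorWords_Iio (z : L₁.U ⊗[k] L₂.U) :
    ∃ n, z ∈ tensorWords L₁ L₂ (Set.Iio n) := by
  induction z using TensorProduct.induction_on with
  | zero => exact ⟨0, zero_mem _⟩
  | tmul a b =>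
    obtain ⟨m, hm⟩ := L₁.exists_mem_filLT a
    obtain ⟨n, hn⟩ := L₂.exists_mem_filLT b
    exact ⟨m + n, tmul_mem_tensorWords hm hn (Nat.le_succ _)⟩
  | add z z' hz hz' =>
    obtain ⟨n, hn⟩ := hz
    obtain ⟨n', hn'⟩ := hz'
    exact ⟨max n n', add_mem (tensorWords_mono (Set.Iio_subset_Iio (le_max_left _ _)) hn)
      (tensorWords_mono (Set.Iio_subset_Iio (le_max_right _ _)) hn')⟩

theorem map_mem_tensorWords {T₁ : L₁.U →ₗ[k] N₁.U} {T₂ : L₂.U →ₗ[k] N₂.U}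
    (h₁ : ∀ n, ∀ u ∈ L₁.filLT n, T₁ u ∈ N₁.filLT n) (h₂ : ∀ n, ∀ u ∈ L₂.filLT n, T₂ u ∈ N₂.filLT n)
    {n : ℕ} {z : L₁.U ⊗[k] L₂.U} (hz : z ∈ tensorWords L₁ L₂ (Set.Iio n)) :
    TensorProduct.map T₁ T₂ z ∈ tensorWords N₁ N₂ (Set.Iio n) := by
  suffices h : tensorWords L₁ L₂ (Set.Iio n) ≤ (tensorWords N₁ N₂ (Set.Iio n)).comap
      (TensorProduct.map T₁ T₂) from h hz
  refine tensorWords_le_iff.2 fun l l' hl hl' hn => ?_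
  rw [Set.mem_Iio] at hn
  exact tmul_mem_tensorWords (h₁ _ _ (L₁.prodι_mem_filLT hl (Nat.lt_succ_self _)))
    (h₂ _ _ (L₂.prodι_mem_filLT hl' (Nat.lt_succ_self _))) (by omega)

end TensorWords

section Splitting

open CoalgebraStruct

variable {k g g₁ g₂ : Type*} [Field k] [AddCommGroup g] [Module k g] [AddCommGroup g₁]
  [Module k g₁] [AddCommGroup g₂] [Module k g₂] {L : GradedLieSuperalgebra k g}
  {L₁ : GradedLieSuperalgebra k g₁} {L₂ : GradedLieSuperalgebra k g₂}
  {F₁ : L.U →ₐ[k] L₁.U} {F₂ : L.U →ₐ[k] L₂.U} {f₁ : g →ₗ[k] g₁} {f₂ : g →ₗ[k] g₂}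

theorem map_primMul_of_right_eq_zero (hF₁ : ∀ x, F₁ (L.ι x) = L₁.ι (f₁ x))
    (hF₂ : ∀ x, F₂ (L.ι x) = L₂.ι (f₂ x)) {d : Bideg} {x : g} (hx : f₂ x = 0) (z : L.U ⊗[k] L.U) :
    TensorProduct.map F₁.toLinearMap F₂.toLinearMap (L.primMul d x z) =
      (LinearMap.mulLeft k (L₁.ι (f₁ x))).rTensor L₂.U
        (TensorProduct.map F₁.toLinearMap F₂.toLinearMap z) := by
  induction z using TensorProduct.induction_on with
  | zero => simp
  | add z z' hz hz' => simp only [map_add, hz, hz']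
  | tmul a b => simp [primMul_tmul, hF₁, hF₂, hx]

theorem map_primMul_of_left_eq_zero (hF₁ : ∀ x, F₁ (L.ι x) = L₁.ι (f₁ x))
    (hF₂ : ∀ x, F₂ (L.ι x) = L₂.ι (f₂ x)) (hf₁ : ∀ d x, x ∈ L.comp d → f₁ x ∈ L₁.comp d)
    {d : Bideg} {x : g} (hx : f₁ x = 0) (z : L.U ⊗[k] L.U) :
    TensorProduct.map F₁.toLinearMap F₂.toLinearMap (L.primMul d x z) =
      TensorProduct.map (twist L₁.grading d) (LinearMap.mulLeft k (L₂.ι (f₂ x)))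
        (TensorProduct.map F₁.toLinearMap F₂.toLinearMap z) := by
  induction z using TensorProduct.induction_on with
  | zero => simp
  | add z z' hz hz' => simp only [map_add, hz, hz']
  | tmul a b =>
    have htwist := map_twist L.grading (f := F₁.toLinearMap) (algHom_mem_grading hF₁ hf₁) d a
    rw [AlgHom.toLinearMap_apply, AlgHom.toLinearMap_apply] at htwist
    simp [primMul_tmul, hF₁, hF₂, hx, htwist]

variable {i₁ : g₁ →ₗ[k] g} {i₂ : g₂ →ₗ[k] g}

theorem map_comul_prodι_of_left_eq_zero (hF₁ : ∀ x, F₁ (L.ι x) = L₁.ι (f₁ x))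
    (hF₂ : ∀ x, F₂ (L.ι x) = L₂.ι (f₂ x)) (hf₁ : ∀ d x, x ∈ L.comp d → f₁ x ∈ L₁.comp d)
    (hi₂ : ∀ d x, x ∈ L₂.comp d → i₂ x ∈ L.comp d) (h₁ : f₁ ∘ₗ i₂ = 0)
    (h₂ : f₂ ∘ₗ i₂ = LinearMap.id) {l : List (Bideg × g₂)} (hl : L₂.IsHomog l) :
    TensorProduct.map F₁.toLinearMap F₂.toLinearMap
      (comul (L.prodι (l.map (Prod.map id i₂)))) = 1 ⊗ₜ L₂.prodι l := by
  induction l with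
  | nil => simp [comul_one]
  | cons a l ih =>
    rw [isHomog_cons] at hl
    rw [List.map_cons, prodι_cons, Prod.map_snd, comul_ι_mul (hi₂ _ _ hl.1),
      map_primMul_of_left_eq_zero hF₁ hF₂ hf₁ (LinearMap.congr_fun h₁ a.2), ih hl.2,
      TensorProduct.map_tmul, twist_one, LinearMap.mulLeft_apply, prodι_cons]
    exact congrArg (fun y => 1 ⊗ₜ (L₂.ι y * L₂.prodι l)) (LinearMap.congr_fun h₂ a.2)

/-- Comultiplying separates the two summands of a direct sum decomposition with projections `f₁`,
`f₂` and inclusions `i₁`, `i₂`. -/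
theorem map_comul_prodι_append (hF₁ : ∀ x, F₁ (L.ι x) = L₁.ι (f₁ x))
    (hF₂ : ∀ x, F₂ (L.ι x) = L₂.ι (f₂ x)) (hf₁ : ∀ d x, x ∈ L.comp d → f₁ x ∈ L₁.comp d)
    (hi₁ : ∀ d x, x ∈ L₁.comp d → i₁ x ∈ L.comp d) (hi₂ : ∀ d x, x ∈ L₂.comp d → i₂ x ∈ L.comp d)
    (h₁₁ : f₁ ∘ₗ i₁ = LinearMap.id) (h₁₂ : f₁ ∘ₗ i₂ = 0) (h₂₁ : f₂ ∘ₗ i₁ = 0)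
    (h₂₂ : f₂ ∘ₗ i₂ = LinearMap.id) {l₁ : List (Bideg × g₁)} {l₂ : List (Bideg × g₂)}
    (hl₁ : L₁.IsHomog l₁) (hl₂ : L₂.IsHomog l₂) :
    TensorProduct.map F₁.toLinearMap F₂.toLinearMap
      (comul (L.prodι (l₁.map (Prod.map id i₁) ++ l₂.map (Prod.map id i₂)))) =
      L₁.prodι l₁ ⊗ₜ L₂.prodι l₂ := by
  induction l₁ with
  | nil => simpa using map_comul_prodι_of_left_eq_zero hF₁ hF₂ hf₁ hi₂ h₁₂ h₂₂ hl₂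
  | cons a l ih =>
    rw [isHomog_cons] at hl₁
    rw [List.map_cons, List.cons_append, prodι_cons, Prod.map_snd, comul_ι_mul (hi₁ _ _ hl₁.1),
      map_primMul_of_right_eq_zero hF₁ hF₂ (LinearMap.congr_fun h₂₁ a.2), ih hl₁.2,
      LinearMap.rTensor_tmul, LinearMap.mulLeft_apply, prodι_cons]
    exact congrArg (fun y => (L₁.ι y * L₁.prodι l) ⊗ₜ L₂.prodι l₂) (LinearMap.congr_fun h₁₁ a.2)

theorem map_comul_mem_tensorWords (hF₁ : ∀ x, F₁ (L.ι x) = L₁.ι (f₁ x))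
    (hF₂ : ∀ x, F₂ (L.ι x) = L₂.ι (f₂ x)) (hf₁ : ∀ d x, x ∈ L.comp d → f₁ x ∈ L₁.comp d)
    (hf₂ : ∀ d x, x ∈ L.comp d → f₂ x ∈ L₂.comp d) {n : ℕ} {u : L.U} (hu : u ∈ L.filLT n) :
    TensorProduct.map F₁.toLinearMap F₂.toLinearMap (comul u) ∈
      tensorWords L₁ L₂ (Set.Iio n) := by
  refine map_mem_tensorWords ((hasSymbol_algHom hF₁).mem_filLT hf₁)
    ((hasSymbol_algHom hF₂).mem_filLT hf₂) ?_
  suffices h : L.filLT n ≤ (tensorWords L L (Set.Iio n)).comap (comul (R := k)) from h hu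
  refine L.filLT_le_iff.2 fun l hl hn => ?_
  have hle : tensorWords L L {l.length} ≤ tensorWords L L (Set.Iio n) :=
    tensorWords_mono (Set.singleton_subset_iff.2 hn)
  exact Submodule.mem_comap.2 (hle (comul_prodι_mem_tensorWords hl))

end Splitting

end GradedLieSuperalgebra

namespace GradedSuperspace

variable {k V V' : Type*} [Field k] [AddCommGroup V] [Module k V] [AddCommGroup V'] [Module k V']
  {G : GradedSuperspace k V} {G' : GradedSuperspace k V'}

theorem symι_mul_symι {i j : Bideg} {x y : V} (hx : x ∈ G.comp i) (hy : y ∈ G.comp j) :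
    G.symι x * G.symι y = koszulSign i j • (G.symι y * G.symι x) := by
  have h := G.abelian.ι_mul_ι hx hy
  rwa [show G.abelian.bracket x y = 0 from rfl, map_zero, add_zero] at h

/-- The algebra map `Sym(V) → Sym(V')` induced by a linear map `V → V'` which preserves degree and
parity. -/
def symMap (f : V →ₗ[k] V') (hf : ∀ d x, x ∈ G.comp d → f x ∈ G'.comp d) : G.Sym →ₐ[k] G'.Sym :=
  G.abelian.lift (G'.symι ∘ₗ f) fun hx hy => by
    simpa [abelian] using symι_mul_symι (hf _ _ hx) (hf _ _ hy)

theorem symMap_ι (f : V →ₗ[k] V') (hf : ∀ d x, x ∈ G.comp d → f x ∈ G'.comp d) (x : V) :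
    symMap f hf (G.symι x) = G'.symι (f x) :=
  G.abelian.lift_ι (G'.symι ∘ₗ f) (fun hx hy => by
    simpa [abelian] using symι_mul_symι (hf _ _ hx) (hf _ _ hy)) x

theorem exists_add_eq {G : GradedSuperspace k V} {H M : GradedSubspace G}
    (h : Codisjoint H.carrier M.carrier) {d : Bideg} {x : V} (hx : x ∈ G.comp d) :
    ∃ y ∈ H.carrier ⊓ G.comp d, ∃ z ∈ M.carrier ⊓ G.comp d, y + z = x := by
  let C : Bideg → Submodule k V := fun d => (H.carrier ⊓ G.comp d) ⊔ (M.carrier ⊓ G.comp d)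
  have hC (e : Bideg) : C e ≤ G.comp e := sup_le inf_le_right inf_le_right
  have htop : ⨆ e, C e = ⊤ := by
    rw [eq_top_iff, ← codisjoint_iff.1 h, iSup_sup_eq]
    exact sup_le_sup H.graded M.graded
  have hle : (⊤ : Submodule k V) ≤ C d ⊔ ⨆ (e) (_ : e ≠ d), G.comp e := by
    rw [← htop]
    refine iSup_le fun e => ?_
    by_cases he : e = d
    · exact he ▸ le_sup_left
    · exact le_sup_of_le_right ((hC e).trans (le_iSup₂_of_le e he le_rfl))
  obtain ⟨c, hc, e, he, rfl⟩ := Submodule.mem_sup.1 (hle (Submodule.mem_top (x := x)))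
  have he0 : e = 0 := Submodule.disjoint_def.1 (G.isInternal.submodule_iSupIndep d) e
    ((Submodule.add_mem_iff_right _ (hC d hc)).1 hx) he
  rw [he0, add_zero]
  exact Submodule.mem_sup.1 hc

theorem projectionOnto_mem_comp {H M : GradedSubspace G} (h : IsCompl H.carrier M.carrier)
    (d : Bideg) (x : V) (hx : x ∈ G.comp d) :
    Submodule.projectionOnto _ _ h x ∈ H.toSuperspace.comp d := by
  obtain ⟨y, hy, z, hz, rfl⟩ := exists_add_eq h.codisjoint hx
  rw [map_add, Submodule.projectionOnto_apply_of_mem_left h hy.1,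
    Submodule.projectionOnto_apply_of_mem_right h hz.1, add_zero]
  exact hy.2

end GradedSuperspace

/-! ### The isomorphism -/

theorem injective_of_forall_sub_mem {k E : Type*} [Ring k] [AddCommGroup E] [Module k E]
    {F : ℕ → Submodule k E} (hzero : F 0 = ⊥) (hF : ∀ z, ∃ n, z ∈ F n) {T : E →ₗ[k] E}
    (hT : ∀ n, ∀ z ∈ F (n + 1), T z - z ∈ F n) : Function.Injective T := by
  refine (injective_iff_map_eq_zero T).2 fun z hz => ?_
  obtain ⟨n, hn⟩ := hF z
  induction n with
  | zero => rwa [hzero] at hn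
  | succ n ih => exact ih (by simpa [hz] using hT n z hn)

namespace GradedLieSuperalgebra

variable {k g : Type*} [Field k] [AddCommGroup g] [Module k g] {L : GradedLieSuperalgebra k g}

theorem exists_ι_mul_sub_smul_mem_filLT {d : Bideg} {z : g} (hz : z ∈ L.comp d)
    {w w' : List (Bideg × g)} (hw : L.IsHomog w) (hw' : L.IsHomog w') {u v : L.U}
    (hu : u - L.prodι (w ++ w') ∈ L.filLT (w.length + w'.length))
    (hv : v - L.prodι (w ++ (d, z) :: w') ∈ L.filLT (w.length + (w'.length + 1))) :
    ∃ c : k, L.ι z * u - c • v ∈ L.filLT (w.length + w'.length + 1) := by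
  obtain ⟨c, hc⟩ := L.exists_prodι_sub_smul_prodι_mem_filLT
    (List.perm_middle (a := (d, z)) (l₁ := w) (l₂ := w')).symm
    (isHomog_cons.2 ⟨hz, isHomog_append.2 ⟨hw, hw'⟩⟩)
  rw [prodι_cons, List.length_cons, List.length_append] at hc
  refine ⟨c, ?_⟩
  convert sub_mem (add_mem (L.ι_mul_mem_filLT z hu) hc) (Submodule.smul_mem _ c hv) using 1
  rw [mul_sub, smul_sub]
  abel

end GradedLieSuperalgebra

namespace GradedLieSubalgebra

open CoalgebraStruct GradedLieSuperalgebra GradedSuperspace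

variable {k g : Type*} [Field k] [AddCommGroup g] [Module k g]
  {L : GradedLieSuperalgebra k g} {H : GradedLieSubalgebra L}
  {M : GradedSubspace L.toGradedSuperspace}

theorem ι_mul_mulSymmetrize_tmul (y : H.carrier) (a : H.toLie.U) (s : M.toSuperspace.Sym) :
    L.ι y * H.mulSymmetrize M (a ⊗ₜ s) = H.mulSymmetrize M ((H.toLie.ι y * a) ⊗ₜ s) := by
  rw [mulSymmetrize_tmul, mulSymmetrize_tmul, map_mul, incl_ι, mul_assoc]
  rfl

variable [CharZero k]

theorem mulSymmetrize_prodι_tmul_prodι_sub_mem_filLT {l : List (Bideg × H.carrier)}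
    {l' : List (Bideg × M.carrier)} (hl : H.toLie.IsHomog l)
    (hl' : M.toSuperspace.abelian.IsHomog l') :
    H.mulSymmetrize M (H.toLie.prodι l ⊗ₜ M.toSuperspace.abelian.prodι l') -
      L.prodι (l.map (Prod.map id H.carrier.subtype) ++
        l'.map (Prod.map id M.carrier.subtype)) ∈ L.filLT (l.length + l'.length) := by
  have hincl := hasSymbol_algHom H.incl_ι
  have hsymm : HasSymbol _ L _ _ := hasSymbol_symmetrize (G := M.toSuperspace)
    (f := M.carrier.subtype) fun _ _ hy => hy
  rw [mulSymmetrize_tmul, prodι_append]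
  exact L.mul_sub_mul_mem_filLT
    (hsymm.mem_filLT (fun _ _ hy => hy) _ _ (prodι_mem_filLT _ hl' (Nat.lt_succ_self _)))
    (L.prodι_mem_filLT (hl.map fun _ _ hx => hx) (by simp)) (hincl l hl) (hsymm l' hl')

theorem exists_ι_mul_mulSymmetrize_sub_mem_filLT {d : Bideg} {z : M.carrier}
    (hz : z ∈ M.toSuperspace.comp d) {l : List (Bideg × H.carrier)}
    {l' : List (Bideg × M.carrier)} (hl : H.toLie.IsHomog l)
    (hl' : M.toSuperspace.abelian.IsHomog l') :
    ∃ c : k, L.ι z * H.mulSymmetrize M (H.toLie.prodι l ⊗ₜ M.toSuperspace.abelian.prodι l') -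
      c • H.mulSymmetrize M
        (H.toLie.prodι l ⊗ₜ M.toSuperspace.abelian.prodι ((d, z) :: l')) ∈
      L.filLT (l.length + l'.length + 1) := by
  have hzl : M.toSuperspace.abelian.IsHomog ((d, z) :: l') := isHomog_cons.2 ⟨hz, hl'⟩
  have hw : L.IsHomog (l.map (Prod.map id H.carrier.subtype)) := hl.map fun _ _ hx => hx
  have hw' : L.IsHomog (l'.map (Prod.map id M.carrier.subtype)) := hl'.map fun _ _ hx => hx
  simpa only [List.length_map] using exists_ι_mul_sub_smul_mem_filLT
    (z := (z : g)) hz hw hw'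
    (by simpa only [List.length_map] using mulSymmetrize_prodι_tmul_prodι_sub_mem_filLT hl hl')
    (by simpa only [List.length_map, List.length_cons, List.map_cons, Prod.map_apply, id,
      Submodule.subtype_apply] using mulSymmetrize_prodι_tmul_prodι_sub_mem_filLT hl hzl)

theorem filLT_le_map_mulSymmetrize (h : Codisjoint H.carrier M.carrier) (n : ℕ) :
    L.filLT n ≤ (tensorWords H.toLie M.toSuperspace.abelian (Set.Iio n)).map
      (H.mulSymmetrize M) := by
  induction n with
  | zero => simp [filLT_zero]
  | succ n ih =>
    set W := (tensorWords H.toLie M.toSuperspace.abelian (Set.Iio (n + 1))).map (H.mulSymmetrize M)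
    have hn : L.filLT n ≤ W := ih.trans
      (Submodule.map_mono (tensorWords_mono (Set.Iio_subset_Iio n.le_succ)))
    have hword {l : List (Bideg × H.carrier)} {l' : List (Bideg × M.carrier)}
        (hl : H.toLie.IsHomog l) (hl' : M.toSuperspace.abelian.IsHomog l')
        (hlt : l.length + l'.length < n + 1) : H.mulSymmetrize M
          (H.toLie.prodι l ⊗ₜ M.toSuperspace.abelian.prodι l') ∈ W :=
      Submodule.mem_map_of_mem (prodι_tmul_prodι_mem_tensorWords hl hl' hlt)
    refine L.filLT_le_iff.2 fun l hl hlt => ?_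
    cases l with
    | nil => simpa [mulSymmetrize_tmul, symmetrize_one] using
        hword (l := []) (l' := []) isHomog_nil isHomog_nil n.succ_pos
    | cons a l =>
      rw [isHomog_cons] at hl
      obtain ⟨y, hy, z, hz, hyz⟩ := exists_add_eq h hl.1
      obtain ⟨t, ht, htl⟩ := ih (L.prodι_mem_filLT hl.2 (Nat.succ_lt_succ_iff.1 hlt))
      suffices hle : tensorWords H.toLie M.toSuperspace.abelian (Set.Iio n) ≤
          W.comap (LinearMap.mulLeft k (L.ι a.2) ∘ₗ H.mulSymmetrize M) by
        simpa [htl] using hle ht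
      refine tensorWords_le_iff.2 fun l₁ l₂ hl₁ hl₂ hlt => ?_
      rw [Set.mem_Iio] at hlt
      rw [Submodule.mem_comap, LinearMap.comp_apply, LinearMap.mulLeft_apply, ← hyz, map_add,
        add_mul]
      refine add_mem ?_ ?_
      · rw [ι_mul_mulSymmetrize_tmul ⟨y, hy.1⟩]
        exact hword (l := (a.1, ⟨y, hy.1⟩) :: l₁) (isHomog_cons.2 ⟨hy.2, hl₁⟩) hl₂
          (by simp only [List.length_cons]; omega)
      · obtain ⟨c, hc⟩ := exists_ι_mul_mulSymmetrize_sub_mem_filLT (z := ⟨z, hz.1⟩) (d := a.1)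
          hz.2 hl₁ hl₂
        refine (Submodule.sub_mem_iff_left _ (Submodule.smul_mem _ c ?_)).1
          (hn (L.filLT_mono hlt hc))
        exact hword hl₁ (isHomog_cons.2 ⟨hz.2, hl₂⟩) (by simp only [List.length_cons]; omega)

theorem mulSymmetrize_surjective (h : Codisjoint H.carrier M.carrier) :
    Function.Surjective (H.mulSymmetrize M) := fun u => by
  obtain ⟨n, hn⟩ := L.exists_mem_filLT u
  obtain ⟨t, -, rfl⟩ := filLT_le_map_mulSymmetrize h n hn
  exact ⟨t, rfl⟩

end GradedLieSubalgebra

namespace GradedLieSubalgebra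

open CoalgebraStruct GradedLieSuperalgebra GradedSuperspace

variable {k g : Type*} [Field k] [AddCommGroup g] [Module k g]
  {L : GradedLieSuperalgebra k g} {H : GradedLieSubalgebra L}
  {M : GradedSubspace L.toGradedSuperspace}

/-- The composite `Sym(g) → Sym(h) ⊗ Sym(m) → U(h) ⊗ Sym(m)` of the comultiplication, projected to
the two summands of `g = h ⊕ m`, with the symmetrization of the first factor. -/
def splitSym (h : IsCompl H.carrier M.carrier) :
    L.toGradedSuperspace.Sym →ₗ[k] H.toLie.U ⊗[k] M.toSuperspace.Sym :=
  TensorProduct.map (H.toSuperspace.symmetrize H.toLie.ι) LinearMap.id ∘ₗ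
    TensorProduct.map (symMap _ (projectionOnto_mem_comp h)).toLinearMap
      (symMap _ (projectionOnto_mem_comp h.symm)).toLinearMap ∘ₗ comul

variable [CharZero k]

theorem map_symmetrize_mem_tensorWords {n : ℕ} {z : H.toSuperspace.Sym ⊗[k] M.toSuperspace.Sym}
    (hz : z ∈ tensorWords H.toSuperspace.abelian M.toSuperspace.abelian (Set.Iio n)) :
    TensorProduct.map (H.toSuperspace.symmetrize H.toLie.ι) LinearMap.id z ∈
      tensorWords H.toLie M.toSuperspace.abelian (Set.Iio n) :=
  map_mem_tensorWords ((hasSymbol_symmetrize_ι H.toLie).mem_filLT fun _ _ hx => hx)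
    (fun _ _ hu => hu) hz

theorem splitSym_mem_tensorWords (h : IsCompl H.carrier M.carrier) {n : ℕ}
    {u : L.toGradedSuperspace.Sym} (hu : u ∈ L.toGradedSuperspace.abelian.filLT n) :
    splitSym h u ∈ tensorWords H.toLie M.toSuperspace.abelian (Set.Iio n) :=
  map_symmetrize_mem_tensorWords (map_comul_mem_tensorWords
    (symMap_ι _ (projectionOnto_mem_comp h)) (symMap_ι _ (projectionOnto_mem_comp h.symm))
    (projectionOnto_mem_comp h) (projectionOnto_mem_comp h.symm) hu)

theorem splitSym_prodι_sub_mem_tensorWords (h : IsCompl H.carrier M.carrier)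
    {l : List (Bideg × H.carrier)} {l' : List (Bideg × M.carrier)} (hl : H.toLie.IsHomog l)
    (hl' : M.toSuperspace.abelian.IsHomog l') :
    splitSym h (L.toGradedSuperspace.abelian.prodι (l.map (Prod.map id H.carrier.subtype) ++
        l'.map (Prod.map id M.carrier.subtype))) -
      H.toLie.prodι l ⊗ₜ M.toSuperspace.abelian.prodι l' ∈
      tensorWords H.toLie M.toSuperspace.abelian (Set.Iio (l.length + l'.length)) := by
  have hsplit := map_comul_prodι_append (L := L.toGradedSuperspace.abelian)
    (L₁ := H.toSuperspace.abelian) (L₂ := M.toSuperspace.abelian)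
    (symMap_ι _ (projectionOnto_mem_comp h)) (symMap_ι _ (projectionOnto_mem_comp h.symm))
    (projectionOnto_mem_comp h) (i₁ := H.carrier.subtype) (i₂ := M.carrier.subtype)
    (fun _ _ hx => hx) (fun _ _ hx => hx)
    (Submodule.projectionOnto_comp_subtype h)
    (by ext y; simp) (by ext y; simp)
    (Submodule.projectionOnto_comp_subtype h.symm) (l₁ := l) hl hl'
  have hsymm := hasSymbol_symmetrize_ι H.toLie l hl
  rw [LinearMap.id_coe, Prod.map_id, List.map_id] at hsymm
  rw [splitSym, LinearMap.comp_apply, LinearMap.comp_apply, hsplit, TensorProduct.map_tmul,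
    LinearMap.id_apply, ← TensorProduct.sub_tmul]
  exact tmul_mem_tensorWords hsymm (prodι_mem_filLT _ hl' (Nat.lt_succ_self _)) le_rfl

theorem exists_linearMap_mulSymmetrize_sub_mem (h : IsCompl H.carrier M.carrier) :
    ∃ T : L.U →ₗ[k] H.toLie.U ⊗[k] M.toSuperspace.Sym,
      ∀ n, ∀ z ∈ tensorWords H.toLie M.toSuperspace.abelian (Set.Iio (n + 1)),
        T (H.mulSymmetrize M z) - z ∈ tensorWords H.toLie M.toSuperspace.abelian (Set.Iio n) := by
  obtain ⟨P, hP⟩ := L.exists_linearMap_prodι_sub_prodι_mem_filLT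
  have hsymbol : HasSymbol L L.toGradedSuperspace.abelian P LinearMap.id := fun l _ => by
    simpa using hP l
  refine ⟨splitSym h ∘ₗ P, fun n z hz => ?_⟩
  suffices hle : tensorWords H.toLie M.toSuperspace.abelian (Set.Iio (n + 1)) ≤
      (tensorWords H.toLie M.toSuperspace.abelian (Set.Iio n)).comap
        ((splitSym h ∘ₗ P) ∘ₗ H.mulSymmetrize M - LinearMap.id) from hle hz
  refine tensorWords_le_iff.2 fun l l' hl hl' hlt => ?_
  refine tensorWords_mono (Set.Iio_subset_Iio (Nat.lt_succ_iff.1 hlt)) ?_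
  set w := l.map (Prod.map id H.carrier.subtype) ++ l'.map (Prod.map id M.carrier.subtype)
  have hP₁ := hsymbol.mem_filLT (fun _ _ hx => hx) _ _
    (mulSymmetrize_prodι_tmul_prodι_sub_mem_filLT hl hl')
  have hP₂ : P (L.prodι w) - L.toGradedSuperspace.abelian.prodι w ∈
      L.toGradedSuperspace.abelian.filLT (l.length + l'.length) := by simpa [w] using hP w
  have hP₃ := splitSym_mem_tensorWords h (add_mem hP₁ hP₂)
  convert add_mem hP₃ (splitSym_prodι_sub_mem_tensorWords h hl hl') using 1
  simp [w, map_sub]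

theorem mulSymmetrize_injective (h : IsCompl H.carrier M.carrier) :
    Function.Injective (H.mulSymmetrize M) := by
  obtain ⟨T, hT⟩ := exists_linearMap_mulSymmetrize_sub_mem h
  refine Function.Injective.of_comp (f := T) ?_
  exact injective_of_forall_sub_mem (T := T ∘ₗ H.mulSymmetrize M) tensorWords_Iio_zero
    exists_mem_tensorWords_Iio hT

end GradedLieSubalgebra

namespace GradedLieSubalgebra

open CoalgebraStruct

variable {k g : Type*} [Field k] [CharZero k] [AddCommGroup g] [Module k g]
  {L : GradedLieSuperalgebra k g} (H : GradedLieSubalgebra L)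
  (M : GradedSubspace L.toGradedSuperspace)

/-- The map `mulSymmetrize` as a morphism of coalgebras, on the graded tensor product. -/
def mulSymmetrizeCoalgHom : (H.toLie.grading ᵍ⊗[k] M.toSuperspace.symGrading) →ₗc[k] L.U where
  __ := H.mulSymmetrize M ∘ₗ
    (GradedTensorProduct.of k H.toLie.grading M.toSuperspace.symGrading).symm.toLinearMap
  counit_comp := GradedTensorProduct.hom_ext _ _ (TensorProduct.ext'
    (H.counit_mulSymmetrize_tmul M))
  map_comp_comul := by
    refine GradedTensorProduct.hom_ext _ _ (TensorProduct.ext' fun a s => ?_)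
    refine Eq.trans ?_ (H.comul_mulSymmetrize_tmul M a s).symm
    exact TensorProduct.map_map _ _ _ _ _

variable {H M}

/-- The isomorphism of coalgebras `U(h) ⊗ Sym(m) ≃ U(g)` attached to a decomposition
`g = h ⊕ m`. -/
def pbwEquiv (h : IsCompl H.carrier M.carrier) :
    (H.toLie.grading ᵍ⊗[k] M.toSuperspace.symGrading) ≃ₗc[k] L.U :=
  CoalgEquiv.ofBijective (f := H.mulSymmetrizeCoalgHom M)
    (⟨mulSymmetrize_injective h, mulSymmetrize_surjective h.codisjoint⟩ :
      Function.Bijective (H.mulSymmetrize M))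

theorem pbwEquiv_tmul (h : IsCompl H.carrier M.carrier) (a : H.toLie.U)
    (s : M.toSuperspace.Sym) : pbwEquiv h (a ᵍ⊗ₜ[k] s) =
      H.incl a * M.toSuperspace.symmetrize (L.ι ∘ₗ M.carrier.subtype) s := rfl

theorem pbwEquiv_smul (h : IsCompl H.carrier M.carrier) (a : H.toLie.U)
    (x : H.toLie.grading ᵍ⊗[k] M.toSuperspace.symGrading) :
    pbwEquiv h (a • x) = a • pbwEquiv h x := by
  suffices hmul : ∀ x : H.toLie.U ⊗[k] M.toSuperspace.Sym,
      H.mulSymmetrize M (a • x) = H.incl a * H.mulSymmetrize M x from hmul x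
  intro x
  induction x using TensorProduct.induction_on with
  | zero => rw [smul_zero, map_zero, mul_zero]
  | add x y hx hy => rw [smul_add, map_add, hx, hy, map_add, mul_add]
  | tmul a' s =>
    rw [TensorProduct.smul_tmul', smul_eq_mul, mulSymmetrize_tmul, mulSymmetrize_tmul, map_mul,
      mul_assoc]

theorem pbwEquiv_tmul_prod_symι (h : IsCompl H.carrier M.carrier) (a : H.toLie.U) {p : ℕ}
    {d : Fin p → Bideg} {y : Fin p → M.carrier} (hy : ∀ i, (y i : g) ∈ L.comp (d i)) :
    pbwEquiv h (a ᵍ⊗ₜ[k] (List.ofFn fun i => M.toSuperspace.symι (y i)).prod) =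
      H.incl a * ((p.factorial : k)⁻¹ • ∑ σ : Equiv.Perm (Fin p),
        permSign d σ • (List.ofFn fun i => L.ι (y (σ i) : g)).prod) := by
  have hsymm := M.toSuperspace.symmetrize_prodι_ofFn (L.ι ∘ₗ M.carrier.subtype)
    (w := fun i => (d i, y i)) hy
  rw [GradedLieSuperalgebra.prodι, List.map_ofFn] at hsymm
  rw [pbwEquiv_tmul]
  exact congrArg (H.incl a * ·) hsymm

theorem pbwEquiv_tmul_mem_grading (h : IsCompl H.carrier M.carrier) {i j : Bideg} {a : H.toLie.U}
    {s : M.toSuperspace.Sym} (ha : a ∈ H.toLie.grading i) (hs : s ∈ M.toSuperspace.symGrading j) :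
    pbwEquiv h (a ᵍ⊗ₜ[k] s) ∈ L.grading (i + j) := by
  rw [pbwEquiv_tmul]
  exact SetLike.mul_mem_graded (H.incl_mem_grading i a ha)
    (GradedSuperspace.symmetrize_mem_grading (fun _ _ hy => hy) j s hs)

end GradedLieSubalgebra

end

theorem mainTheorem1_general {k g : Type*} [Field k] [CharZero k] [AddCommGroup g] [Module k g]
    (L : GradedLieSuperalgebra k g)
    (H : GradedLieSubalgebra L) (M : GradedSubspace L.toGradedSuperspace)
    (hHM : IsCompl H.carrier M.carrier) :
    ∃ φ : (H.toLie.grading ᵍ⊗[k] M.toSuperspace.symGrading) ≃ₗc[k] L.U,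
      (∀ (a : H.toLie.U) (p : ℕ) (d : Fin p → Bideg) (y : Fin p → M.carrier),
        (∀ i, (y i : g) ∈ L.comp (d i)) →
        φ (a ᵍ⊗ₜ[k] (List.ofFn fun i => M.toSuperspace.symι (y i)).prod) =
          H.incl a * ((p.factorial : k)⁻¹ • ∑ σ : Equiv.Perm (Fin p),
            permSign d σ • (List.ofFn fun i => L.ι (y (σ i) : g)).prod)) ∧
      (∀ (a : H.toLie.U) (x : H.toLie.grading ᵍ⊗[k] M.toSuperspace.symGrading),
        φ (a • x) = a • φ x) ∧
      (∀ (i j : Bideg) (a : H.toLie.U) (s : M.toSuperspace.Sym),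
        a ∈ H.toLie.grading i → s ∈ M.toSuperspace.symGrading j →
        φ (a ᵍ⊗ₜ[k] s) ∈ L.grading (i + j)) :=
  ⟨GradedLieSubalgebra.pbwEquiv hHM,
    fun a _ _ _ hy => GradedLieSubalgebra.pbwEquiv_tmul_prod_symι hHM a hy,
    GradedLieSubalgebra.pbwEquiv_smul hHM,
    fun _ _ _ _ ha hs => GradedLieSubalgebra.pbwEquiv_tmul_mem_grading hHM ha hs⟩

theorem mainTheorem1 {k g I : Type*} [Field k] [CharZero k] [AddCommGroup g] [Module k g]
    (L : GradedLieSuperalgebra k g)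
    [Countable I] (b : Module.Basis I k g) (hb : ∀ i, ∃ d, b i ∈ L.comp d)
    (H : GradedLieSubalgebra L) (M : GradedSubspace L.toGradedSuperspace)
    (hHM : IsCompl H.carrier M.carrier) :
    ∃ φ : (H.toLie.grading ᵍ⊗[k] M.toSuperspace.symGrading) ≃ₗc[k] L.U,
      -- the explicit formula, which determines `φ`
      (∀ (a : H.toLie.U) (p : ℕ) (d : Fin p → Bideg) (y : Fin p → M.carrier),
        (∀ i, (y i : g) ∈ L.comp (d i)) →
        φ (a ᵍ⊗ₜ[k] (List.ofFn fun i => M.toSuperspace.symι (y i)).prod) =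
          H.incl a * ((p.factorial : k)⁻¹ • ∑ σ : Equiv.Perm (Fin p),
            permSign d σ • (List.ofFn fun i => L.ι (y (σ i) : g)).prod)) ∧
      -- `φ` is a morphism of left `U(h)`-modules
      (∀ (a : H.toLie.U) (x : H.toLie.grading ᵍ⊗[k] M.toSuperspace.symGrading),
        φ (a • x) = a • φ x) ∧
      -- `φ` preserves degree and parity
      (∀ (i j : Bideg) (a : H.toLie.U) (s : M.toSuperspace.Sym),
        a ∈ H.toLie.grading i → s ∈ M.toSuperspace.symGrading j →
        φ (a ᵍ⊗ₜ[k] s) ∈ L.grading (i + j)) :=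
  mainTheorem1_general L H M hHM
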